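/- **Setting.** Let $n\ge 1$. A Markov control model with state space $\{1,\dots,n\}$ consists of a topological space $A$ with its Borel $\sigma$-algebra and, for each state $i$, a nonempty Borel set $A_i\subset A$ of actions, a measurable reward $a\mapsto r_i^a\in\mathbb R$ on $A_i$, and a measurable map $a\mapsto P_i^a$ from $A_i$ to the stochastic vectors of $\mathbb R^n$, such that for all $i$ and all $x\in\mathbb R^n$ the supremum $\sup_{a\in A_i}(r_i^a+P_i^a x)$ is attained (and finite). Its dynamic programming operator is $f:\mathbb R^n\to\mathbb R^n$, $f_i(x)=\sup_{a\in A_i}(r_i^a+P_i^a x)$. A randomized strategy $\gamma$ assigns to each $k\ge 0$ and each partial history of states $(i_0,\dots,i_k)$ a probability measure $\gamma_k^{i_0,\dots,i_k}$ on $A$ giving probability $1$ to $A_{i_k}$. With an initial state $i$, it defines a state-action process $(\xi_k,\alpha_k)_{k\ge0}$: $\xi_0=i$; given the past and $\xi_k$, the action $\alpha_k$ has law $\gamma_k^{\xi_0,\dots,\xi_k}$; given the past and $\alpha_k$, the state $\xi_{k+1}$ has law $P^{\alpha_k}_{\xi_k}$. The mean reward is $$\mu_i^\gamma=\liminf_{N\to\infty}\frac1N\,\mathbb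 E^{\gamma,i}\bigl(r_{\xi_0}^{\alpha_0}+\dots+r_{\xi_{N-1}}^{\alpha_{N-1}}\bigr)\in[-\infty,+\infty).$$ A randomized Markovian stationary strategy $\tau^\infty$ is given by probability measures $\tau_1,\dots,\tau_n$ on $A$ with $\tau_i[A_i]=1$, by taking $\gamma_k^{i_0,\dots,i_k}=\tau_{i_k}$; write $\mu^\tau=\mu^{\tau^\infty}$, $P^\tau_{ij}=\int_A P^a_{ij}\,d\tau_i(a)$ and $r^\tau_i=\int_A r_i^a\,d\tau_i(a)\in\mathbb R\cup\{-\infty\}$. A class of a stochastic matrix $P$ is a strongly connected component of the directed graph on $\{1,\dots,n\}$ with an arc $i\to j$ whenever $P_{ij}\ne0$; it is final if no node of it has access to a node outside it. If $F$ is a final class of $P^\tau$, then $m_F^\tau$ denotes the unique invariant measure of the $F\times F$ submatrix of $P^\tau$ (the unique stochastic row vector $m$ with $m\,P^\tau_{FF}=m$), and $r^\tau_F$ the restriction of $r^\tau$ to $F$. For $v\in\mathbb R^n$ let $\partial f(v)=\{P\in\mathbb R^{n\times n} : f(x)-f(v)\ge P(x-v)\ \text{for all } x\in\mathbb R^n\}$;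 its elements are stochastic matrices. Let $C^{\rm c}(f)$ be the set of all final classes of all matrices $P\in\partial f(u)$, where $u$ is an eigenvector of $f$; this set does not depend on the choice of $u$. **Proposition.** Assume that $f$ has an eigenvector $u\in\mathbb R^n$ with eigenvalue $\lambda\in\mathbb R$, that is, $f_i(u)=\lambda+u_i$ for all $i$. Then $$\lambda=\max_{\gamma,\ 1\le i\le n}\mu_i^\gamma=\max_{\tau^\infty,\ 1\le i\le n}\mu_i^\tau ,$$ where the maxima, which are attained, are taken over all randomized strategies $\gamma$ and over all randomized Markovian stationary strategies $\tau^\infty$, respectively. For every randomized Markovian stationary strategy $\tau^\infty$, each final class $F$ of $P^\tau$ has a unique invariant measure $m^\tau_F$ as above, and $$\max_{1\le i\le n}\mu_i^\tau=\max_{F\text{ final class of }P^\tau} m_F^\tau r_F^\tau .$$ Moreover, if all the $A_i$ are compact and all the maps $a\mapsto r_i^a$ and $a\mapsto P_i^a$ are continuous on $A_i$, then the elements of $C^{\rm c}(f)$, computed from any eigenvector $u$, are precisely the sets $F$ such that, for some randomized Markovian stationary strategy $\tau^\infty$, $F$ is a final class of $P^\tau$ and $m_F^\tau r_F^\tau=\lambda$.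 -/

import Mathlib

open MeasureTheory ProbabilityTheory Filter

/-! ### Classes of nonnegative matrices, invariant measures, subdifferentials -/

/-- `i` has access to `j` in the directed graph of `P` (the graph with an arc `k → l` whenever
`P k l ≠ 0`): there is a directed path from `i` to `j`, or `i = j`. -/
def HasAccess {n : ℕ} (P : Matrix (Fin n) (Fin n) ℝ) (i j : Fin n) : Prop :=
  Relation.ReflTransGen (fun k l => P k l ≠ 0) i j

/-- `C` is a class of `P`: an equivalence class of mutual access in the graph of `P`. -/
def IsClassOf {n : ℕ} (P : Matrix (Fin n) (Fin n) ℝ) (C : Finset (Fin n)) : Prop :=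
  ∃ i, ∀ j, j ∈ C ↔ HasAccess P i j ∧ HasAccess P j i

/-- `C` is a final class of `P`: a class with no access to its complement. -/
def IsFinalClass {n : ℕ} (P : Matrix (Fin n) (Fin n) ℝ) (C : Finset (Fin n)) : Prop :=
  IsClassOf P C ∧ ∀ i ∈ C, ∀ j, HasAccess P i j → j ∈ C

/-- `m` is an invariant measure of the `F × F` submatrix of `P`: a stochastic row vector `m`
indexed by `F` with `m P_FF = m`. -/
def IsInvariantMeasureOn {n : ℕ} (P : Matrix (Fin n) (Fin n) ℝ) (F : Finset (Fin n))
    (m : F → ℝ) : Prop :=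
  m ∈ stdSimplex ℝ F ∧
    Matrix.vecMul m (P.submatrix (fun i : F => (i : Fin n)) (fun i : F => (i : Fin n))) = m

open Classical in
/-- The invariant measure of the `F × F` submatrix of `P`, when there is one
(it exists and is unique when `P` is stochastic and `F` is a final class of `P`). -/
noncomputable def invariantMeasureOn {n : ℕ} (P : Matrix (Fin n) (Fin n) ℝ)
    (F : Finset (Fin n)) : F → ℝ :=
  if h : ∃ m, IsInvariantMeasureOn P F m then h.choose else 0

/-- The subdifferential `∂f(v)` of a map `f : ℝⁿ → ℝⁿ`, a set of `n × n` matrices. -/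
def subdifferential {n : ℕ} (f : (Fin n → ℝ) → (Fin n → ℝ)) (v : Fin n → ℝ) :
    Set (Matrix (Fin n) (Fin n) ℝ) :=
  {P | ∀ x, P.mulVec (x - v) ≤ f x - f v}

/-- `C^f(𝒫)`: the set of all final classes of the matrices `P ∈ 𝒫`. -/
def finalClasses {n : ℕ} (S : Set (Matrix (Fin n) (Fin n) ℝ)) : Set (Finset (Fin n)) :=
  {F | ∃ P ∈ S, IsFinalClass P F}

/-- The family `C^c(f)` of final classes of matrices `P ∈ ∂f(v)`, for an eigenvector `v` of `f`.
It does not depend on the choice of the eigenvector `v`. -/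
def criticalFinalClasses {n : ℕ} (f : (Fin n → ℝ) → (Fin n → ℝ)) (v : Fin n → ℝ) :
    Set (Finset (Fin n)) :=
  finalClasses (subdifferential f v)

/-- `u` is an eigenvector of `f` with (additive) eigenvalue `lam`: `f(u) = lam + u`. -/
def IsAddEigenvector {n : ℕ} (f : (Fin n → ℝ) → (Fin n → ℝ)) (lam : ℝ) (u : Fin n → ℝ) : Prop :=
  ∀ i, f u i = lam + u i

/-- Expectation, with values in `[-∞, +∞]`, of a real random variable bounded from above:
`E[g⁺] - E[g⁻]`. -/
noncomputable def extMean {Ω : Type*} [MeasurableSpace Ω] (μ : Measure Ω) (g : Ω → ℝ) : EReal :=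
  ((∫⁻ ω, ENNReal.ofReal (g ω) ∂μ : ENNReal) : EReal) -
    ((∫⁻ ω, ENNReal.ofReal (-g ω) ∂μ : ENNReal) : EReal)

/-! ### Markov control models -/

/-- A Markov control model with state space `Fin n` and action space `A`: nonempty Borel sets
`act i ⊆ A` of admissible actions, measurable instantaneous rewards and transition probabilities
on them, such that `sup_{a ∈ A_i} (r_i^a + P_i^a x)` is attained for all `x`. -/
structure MarkovControlModel (n : ℕ) (A : Type*) [TopologicalSpace A] [MeasurableSpace A]
    [BorelSpace A] where
  /-- The set `A_i` of actions that may be played in state `i`. -/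
  act : Fin n → Set A
  act_nonempty : ∀ i, (act i).Nonempty
  measurableSet_act : ∀ i, MeasurableSet (act i)
  /-- The reward `r_i^a`. -/
  reward : ∀ i, act i → ℝ
  measurable_reward : ∀ i, Measurable (reward i)
  /-- The stochastic vector `P_i^a`. -/
  trans : ∀ i, act i → stdSimplex ℝ (Fin n)
  measurable_trans : ∀ i, Measurable (trans i)
  attained : ∀ (i : Fin n) (x : Fin n → ℝ), ∃ a : act i, ∀ b : act i,
    reward i b + ∑ j, trans i b j * x j ≤ reward i a + ∑ j, trans i a j * x j

namespace MarkovControlModel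

variable {n : ℕ} {A : Type*} [TopologicalSpace A] [MeasurableSpace A] [BorelSpace A]

/-- The dynamic programming operator `f_i(x) = sup_{a ∈ A_i} (r_i^a + P_i^a x)`. -/
noncomputable def dpOperator (M : MarkovControlModel n A) (x : Fin n → ℝ) : Fin n → ℝ :=
  fun i => ⨆ a : M.act i, (M.reward i a + ∑ j, M.trans i a j * x j)

open Classical in
/-- The reward as a function on all of `A`; the (irrelevant) value outside `A_i` is `0`. -/
noncomputable def rewardExt (M : MarkovControlModel n A) (i : Fin n) (a : A) : ℝ :=
  if h : a ∈ M.act i then M.reward i ⟨a, h⟩ else 0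

open Classical in
/-- The transition probabilities as functions on all of `A`; the (irrelevant) value outside `A_i`
is the Dirac mass at `i`. -/
noncomputable def transExt (M : MarkovControlModel n A) (i : Fin n) (a : A) : Fin n → ℝ :=
  if h : a ∈ M.act i then (M.trans i ⟨a, h⟩ : Fin n → ℝ) else Pi.single i 1

theorem measurable_transExt (M : MarkovControlModel n A) (i j : Fin n) :
    Measurable fun a => M.transExt i a j := by
  classical
  have h1 : Measurable fun a : M.act i => M.trans i a j :=
    (measurable_pi_apply j).comp (measurable_subtype_coe.comp (M.measurable_trans i))
  have h2 : (fun a => M.transExt i a j) = fun a =>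
      if h : a ∈ M.act i then M.trans i ⟨a, h⟩ j else (Pi.single i 1 : Fin n → ℝ) j := by
    funext a
    unfold transExt
    split_ifs <;> rfl
  rw [h2]
  exact Measurable.dite h1 measurable_const (M.measurableSet_act i)

theorem transExt_nonneg (M : MarkovControlModel n A) (i : Fin n) (a : A) (j : Fin n) :
    0 ≤ M.transExt i a j := by
  unfold transExt
  split_ifs with h
  · exact (M.trans i ⟨a, h⟩).2.1 j
  · by_cases hij : j = i
    · subst hij; simp
    · simp [hij]

theorem sum_transExt (M : MarkovControlModel n A) (i : Fin n) (a : A) :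
    ∑ j, M.transExt i a j = 1 := by
  unfold transExt
  split_ifs with h
  · exact (M.trans i ⟨a, h⟩).2.2
  · simp

/-- The law of the next state, given the present state and action. -/
noncomputable def stateKernel (M : MarkovControlModel n A) : Kernel (Fin n × A) (Fin n) where
  toFun p := ∑ j, ENNReal.ofReal (M.transExt p.1 p.2 j) • Measure.dirac j
  measurable' := by
    refine Measure.measurable_of_measurable_coe _ fun s _ => ?_
    simp only [Measure.coe_finsetSum, Finset.sum_apply, Measure.smul_apply, smul_eq_mul]
    refine Finset.measurable_sum _ fun j _ => Measurable.mul_const ?_ _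
    refine ENNReal.measurable_ofReal.comp ?_
    exact measurable_from_prod_countable_right fun i => M.measurable_transExt i j

instance (M : MarkovControlModel n A) : IsMarkovKernel M.stateKernel where
  isProbabilityMeasure p := ⟨by
    change (∑ j, ENNReal.ofReal (M.transExt p.1 p.2 j) • Measure.dirac j : Measure (Fin n))
      Set.univ = 1
    simp only [Measure.coe_finsetSum, Finset.sum_apply, Measure.smul_apply, smul_eq_mul,
      measure_univ, mul_one]
    rw [← ENNReal.ofReal_sum_of_nonneg fun j _ => M.transExt_nonneg _ _ j, sum_transExt,
      ENNReal.ofReal_one]⟩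

/-- A (randomized) strategy: to each time `k` and each partial history `(i_0, …, i_k)` of states,
it associates a probability measure on `A` giving probability one to `A_{i_k}`. -/
structure Strategy (M : MarkovControlModel n A) where
  law : (k : ℕ) → (Finset.Iic k → Fin n) → Measure A
  isProb : ∀ k h, IsProbabilityMeasure (law k h)
  law_act : ∀ k h, law k h (M.act (h ⟨k, Finset.mem_Iic.2 le_rfl⟩)) = 1

/-- A family `τ = (τ_i)` of probability measures on `A` with `τ_i[A_i] = 1`: the data of a
(randomized) Markovian stationary strategy `τ^∞`. -/
structure StationaryRule (M : MarkovControlModel n A) where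
  law : Fin n → Measure A
  isProb : ∀ i, IsProbabilityMeasure (law i)
  law_act : ∀ i, law i (M.act i) = 1

variable {M : MarkovControlModel n A}

/-- The Markovian stationary strategy `τ^∞`. -/
def StationaryRule.toStrategy (τ : M.StationaryRule) : M.Strategy where
  law k h := τ.law (h ⟨k, Finset.mem_Iic.2 le_rfl⟩)
  isProb _ _ := τ.isProb _
  law_act _ _ := τ.law_act _

/-- Given the state-action pairs up to time `k` and the state at time `k + 1`, the partial history
of states up to time `k + 1`. -/
def nextHistory {n : ℕ} {A : Type*} (k : ℕ) (p : (Finset.Iic k → Fin n × A) × Fin n) : Finset.Iic (k + 1) → Fin n :=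
  fun j => if h : (j : ℕ) ≤ k then (p.1 ⟨j, Finset.mem_Iic.2 h⟩).1 else p.2

theorem measurable_nextHistory {n : ℕ} {A : Type*} [MeasurableSpace A] (k : ℕ) :
    Measurable (nextHistory (n := n) (A := A) k) := by
  refine measurable_pi_lambda _ fun j => ?_
  unfold nextHistory
  split_ifs with h
  · exact measurable_fst.comp ((measurable_pi_apply _).comp measurable_fst)
  · exact measurable_snd

/-- The law of the action at time `k + 1`, given the state-action pairs up to time `k` and the
state at time `k + 1`. -/
noncomputable def Strategy.actionKernel (γ : M.Strategy) (k : ℕ) :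
    Kernel ((Finset.Iic k → Fin n × A) × Fin n) A where
  toFun p := γ.law (k + 1) (nextHistory k p)
  measurable' := (measurable_of_countable (γ.law (k + 1))).comp (measurable_nextHistory k)

instance (γ : M.Strategy) (k : ℕ) : IsMarkovKernel (γ.actionKernel k) where
  isProbabilityMeasure _ := γ.isProb _ _

/-- The law of the pair (state, action) at time `k + 1`, given the pairs up to time `k`: the state
is drawn from the transition probabilities, then the action from the strategy. -/
noncomputable def Strategy.stepKernel (γ : M.Strategy) (k : ℕ) :
    Kernel (Finset.Iic k → Fin n × A) (Fin n × A) :=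
  (M.stateKernel.comap (fun h => h ⟨k, Finset.mem_Iic.2 le_rfl⟩) (measurable_pi_apply _)) ⊗ₖ
    γ.actionKernel k

instance (γ : M.Strategy) (k : ℕ) : IsMarkovKernel (γ.stepKernel k) := by
  unfold Strategy.stepKernel
  infer_instance

/-- The law of the pair (state, action) at time `0`, for the initial state `i`. -/
noncomputable def Strategy.initialLaw (γ : M.Strategy) (i : Fin n) : Measure (Fin n × A) :=
  (Measure.dirac i).prod (γ.law 0 fun _ => i)

/-- The law of the state-action process `(ξ_k, α_k)_{k ≥ 0}` driven by the strategy `γ`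
from the initial state `i`. -/
noncomputable def Strategy.pathMeasure (γ : M.Strategy) (i : Fin n) :
    Measure (ℕ → Fin n × A) :=
  Kernel.trajMeasure (X := fun _ => Fin n × A) (γ.initialLaw i) γ.stepKernel

/-- The mean reward per time unit
`μ_i^γ = liminf_N (1/N) E^{γ,i}(r_{ξ_0}^{α_0} + ⋯ + r_{ξ_{N-1}}^{α_{N-1}}) ∈ [-∞, +∞]`. -/
noncomputable def Strategy.meanReward (γ : M.Strategy) (i : Fin n) : EReal :=
  liminf (fun N : ℕ => ((1 / (N : ℝ) : ℝ) : EReal) *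
    extMean (γ.pathMeasure i)
      (fun ω => ∑ k ∈ Finset.range N, M.rewardExt (ω k).1 (ω k).2)) atTop

/-- The transition matrix `P^τ_ij = ∫_A P_ij^a dτ_i(a)`. -/
noncomputable def StationaryRule.transMatrix (τ : M.StationaryRule) :
    Matrix (Fin n) (Fin n) ℝ :=
  fun i j => ∫ a, M.transExt i a j ∂(τ.law i)

/-- The vector `r^τ_i = ∫_A r_i^a dτ_i(a) ∈ ℝ ∪ {-∞}`. -/
noncomputable def StationaryRule.meanRewardVector (τ : M.StationaryRule) (i : Fin n) : EReal :=
  extMean (τ.law i) (M.rewardExt i)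

/-- The number `m_F^τ r_F^τ`, where `m_F^τ` is the invariant measure of the `F × F` submatrix
of `P^τ`. -/
noncomputable def StationaryRule.classReward (τ : M.StationaryRule) (F : Finset (Fin n)) : EReal :=
  ∑ i : F, ((invariantMeasureOn τ.transMatrix F i : ℝ) : EReal) * τ.meanRewardVector i

end MarkovControlModel

open scoped Matrix Topology

/-! ### Stationary measures of finite Markov chains -/

section FiniteChain

variable {n : ℕ} {P : Matrix (Fin n) (Fin n) ℝ}

/-! Upper bound. The spectral equation gives `r + P u ≤ lam + u` for every admissible action. Hence,
under any strategy, the expected reward at time `k` is at most `lam` plus the expected decrease of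
`u` between times `k` and `k + 1`. These decreases telescope to a bounded quantity, which disappears
after division by `N` (`Strategy.meanReward_le`).

Attainment. Play in each state an action that is optimal for `u`. On a final class of the resulting
matrix, `r + P u = lam + u`; pairing with the invariant measure `m` cancels `u` and leaves `m r =
lam` (`classReward_eq_of_eigen`). This is the mean reward from any state of the class
(`meanReward_eq_classReward`).

Stationary rules. The law of the state-action pair at time `k` is the mixture of the measures `δ_j ⊗
τ_j` with weights `(P ^ k) i j`, so mean rewards are lower limits of pairings of `r` with occupation
measures. Cluster points of these are stationary measures, from which the invariant measures of
final classes can be peeled off one at a time (`IsStationaryMeasure.dotProduct_le`). Rewards are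
bounded above, so the only degenerate value is `-∞`, taken exactly when some accessible state has a
non-integrable reward.

Critical classes. If `m r = lam` on a final class, the nonnegative defect `lam + u - r - P u` has
zero average against the positive measure `m`, so it vanishes there: the rows of the class are
subgradients, and the other rows can be replaced by optimal ones. Conversely, under compactness,
Hahn–Banach shows that every subgradient row is a convex combination of optimal transition rows
(`mem_convexHull_optimalRows`), and a finitely supported rule realizes it. -/

/-- `m` is a stationary (nonnegative, not necessarily normalized) measure of `P`. -/
def IsStationaryMeasure (P : Matrix (Fin n) (Fin n) ℝ) (m : Fin n → ℝ) : Prop :=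
  0 ≤ m ∧ m ᵥ* P = m

theorem IsFinalClass.hasAccess {F : Finset (Fin n)} (hF : IsFinalClass P F) {i j : Fin n}
    (hi : i ∈ F) (hj : j ∈ F) : HasAccess P i j := by
  obtain ⟨⟨k, hk⟩, -⟩ := hF
  exact ((hk i).1 hi).2.trans ((hk j).1 hj).1

theorem IsFinalClass.nonempty {F : Finset (Fin n)} (hF : IsFinalClass P F) : F.Nonempty := by
  obtain ⟨⟨k, hk⟩, -⟩ := hF
  exact ⟨k, (hk k).2 ⟨.refl, .refl⟩⟩

theorem IsFinalClass.eq_zero {F : Finset (Fin n)} (hF : IsFinalClass P F) {i j : Fin n}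
    (hi : i ∈ F) (hj : j ∉ F) : P i j = 0 := by
  by_contra h
  exact hj (hF.2 i hi j (.single h))

/-- Being a final class only depends on the rows indexed by the class. -/
theorem IsFinalClass.congr {Q : Matrix (Fin n) (Fin n) ℝ} {F : Finset (Fin n)}
    (hF : IsFinalClass P F) (h : ∀ i ∈ F, Q i = P i) : IsFinalClass Q F := by
  have h1 : ∀ i ∈ F, ∀ j, HasAccess Q i j → HasAccess P i j ∧ j ∈ F := by
    intro i hi j hij
    induction hij with
    | refl => exact ⟨.refl, hi⟩
    | tail _ hbc ih =>
      rw [h _ ih.2] at hbc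
      exact ⟨ih.1.tail hbc, hF.2 _ hi _ (ih.1.tail hbc)⟩
  have h2 : ∀ i ∈ F, ∀ j, HasAccess P i j → HasAccess Q i j := by
    intro i hi j hij
    induction hij with
    | refl => exact .refl
    | tail hab hbc ih =>
      refine ih.tail ?_
      rwa [h _ (hF.2 _ hi _ hab)]
  refine ⟨?_, fun i hi j hij => (h1 i hi j hij).2⟩
  obtain ⟨k, hk⟩ := hF.nonempty
  exact ⟨k, fun j => ⟨fun hj => ⟨h2 k hk j (hF.hasAccess hk hj), h2 j hj k (hF.hasAccess hj hk)⟩,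
    fun hj => (h1 k hk j hj.1).2⟩⟩

/-- Every state has access to some final class. -/
theorem exists_isFinalClass_hasAccess (P : Matrix (Fin n) (Fin n) ℝ) (i : Fin n) :
    ∃ F, IsFinalClass P F ∧ ∀ j ∈ F, HasAccess P i j := by
  classical
  let acc : Fin n → Finset (Fin n) := fun j => Finset.univ.filter fun k => HasAccess P j k
  have hacc : ∀ j k, k ∈ acc j ↔ HasAccess P j k := fun j k => by simp [acc]
  -- A state accessible from `i` with the fewest accessible states: every state it reaches has the
  -- same accessible set, hence leads back to it.
  obtain ⟨j, hj, hmin⟩ := Finset.exists_min_image (acc i) (fun j => (acc j).card)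
    ⟨i, (hacc i i).2 .refl⟩
  rw [hacc] at hj
  have hback : ∀ k, HasAccess P j k → HasAccess P k j := by
    intro k hk
    have hsub : acc k ⊆ acc j := fun l hl => (hacc _ _).2 (hk.trans ((hacc _ _).1 hl))
    have := Finset.eq_of_subset_of_card_le hsub (hmin k ((hacc _ _).2 (hj.trans hk)))
    rw [← hacc, this, hacc]
    exact .refl
  refine ⟨acc j, ⟨⟨j, fun k => ?_⟩, fun k hk l hl => ?_⟩, fun k hk => hj.trans ((hacc _ _).1 hk)⟩
  · rw [hacc]
    exact ⟨fun h => ⟨h, hback k h⟩, fun h => h.1⟩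
  · rw [hacc] at hk ⊢
    exact hk.trans hl

theorem IsStationaryMeasure.pos_of_hasAccess (hP : P ∈ Matrix.rowStochastic ℝ (Fin n))
    {m : Fin n → ℝ} (hm : IsStationaryMeasure P m) {i j : Fin n} (hi : 0 < m i)
    (hij : HasAccess P i j) : 0 < m j := by
  induction hij with
  | refl => exact hi
  | @tail b c _ hbc ih =>
    have h0 : 0 < P b c := lt_of_le_of_ne (hP.1 b c) (Ne.symm hbc)
    calc 0 < m b * P b c := mul_pos ih h0
      _ ≤ ∑ k, m k * P k c := Finset.single_le_sum (f := fun k => m k * P k c)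
          (fun k _ => mul_nonneg (hm.1 k) (hP.1 k c)) (Finset.mem_univ b)
      _ = m c := congrFun hm.2 c

theorem IsStationaryMeasure.sub_smul {m q : Fin n → ℝ} (hm : IsStationaryMeasure P m)
    (hq : IsStationaryMeasure P q) {t : ℝ} (h : t • q ≤ m) : IsStationaryMeasure P (m - t • q) :=
  ⟨sub_nonneg.2 h, by rw [Matrix.sub_vecMul, Matrix.smul_vecMul, hm.2, hq.2]⟩

/-- The largest multiple of `q` below `m`, where `q > 0` on `F` and `q = 0` off `F`. -/
theorem exists_smul_le_of_support {m q : Fin n → ℝ} {F : Finset (Fin n)} (hF : F.Nonempty)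
    (hm : 0 ≤ m) (hq : ∀ i ∈ F, 0 < q i) (hq0 : ∀ i ∉ F, q i = 0) :
    ∃ t : ℝ, 0 ≤ t ∧ t • q ≤ m ∧ ∃ i ∈ F, m i = t * q i := by
  -- The multiple is the least ratio `m i / q i` over `F`; a minimizer is a point where the
  -- difference vanishes.
  obtain ⟨i, hi, hmin⟩ := Finset.exists_min_image F (fun i => m i / q i) hF
  refine ⟨m i / q i, div_nonneg (hm i) (hq i hi).le, fun j => ?_, i, hi, ?_⟩
  · by_cases hj : j ∈ F
    · have := hmin j hj
      rw [le_div_iff₀ (hq j hj)] at this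
      simpa using this
    · simpa [hq0 j hj] using hm j
  · rw [div_mul_cancel₀ _ (hq i hi).ne']

/-- A stationary probability measure supported by a final class charges each of its points. -/
theorem IsFinalClass.stationary_pos (hP : P ∈ Matrix.rowStochastic ℝ (Fin n))
    {F : Finset (Fin n)} (hF : IsFinalClass P F) {q : Fin n → ℝ} (hq : IsStationaryMeasure P q)
    (hq1 : ∑ i, q i = 1) (hq0 : ∀ i ∉ F, q i = 0) : ∀ i ∈ F, 0 < q i := by
  intro i hi
  obtain ⟨k, -, hk⟩ : ∃ k ∈ Finset.univ, 0 < q k := by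
    refine (Finset.sum_pos_iff_of_nonneg fun j _ => hq.1 j).1 ?_
    rw [hq1]; exact one_pos
  have hkF : k ∈ F := by
    by_contra h
    rw [hq0 k h] at hk
    exact hk.false
  exact hq.pos_of_hasAccess hP hk (hF.hasAccess hkF hi)

/-- Subtracting from `m` the largest multiple of `q` below it leaves a stationary measure that
vanishes at some point of `F`. Positivity propagates along access, so the remainder vanishes on all
of `F`, and normalization forces the multiple to be `1`. -/
theorem IsFinalClass.stationary_unique (hP : P ∈ Matrix.rowStochastic ℝ (Fin n))
    {F : Finset (Fin n)} (hF : IsFinalClass P F) {m q : Fin n → ℝ} (hm : IsStationaryMeasure P m)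
    (hm1 : ∑ i, m i = 1) (hm0 : ∀ i ∉ F, m i = 0) (hq : IsStationaryMeasure P q)
    (hq1 : ∑ i, q i = 1) (hq0 : ∀ i ∉ F, q i = 0) : m = q := by
  obtain ⟨t, -, htle, i, hi, hti⟩ := exists_smul_le_of_support hF.nonempty hm.1
    (hF.stationary_pos hP hq hq1 hq0) hq0
  have hs := hm.sub_smul hq htle
  have h0 : m - t • q = 0 := by
    funext j
    by_cases hj : j ∈ F
    · by_contra hne
      have hpos : 0 < (m - t • q) j := lt_of_le_of_ne (hs.1 j) (Ne.symm hne)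
      have := hs.pos_of_hasAccess hP hpos (hF.hasAccess hj hi)
      simp [hti] at this
    · simp [hm0 j hj, hq0 j hj]
  have h1 : m = t • q := sub_eq_zero.1 h0
  have h2 : t = 1 := by
    rw [h1] at hm1
    simpa [← Finset.mul_sum, hq1] using hm1
  rw [h1, h2, one_smul]

/-- A linear functional bounded on the extremal stationary measures is bounded on all of them. -/
theorem IsStationaryMeasure.dotProduct_le (hP : P ∈ Matrix.rowStochastic ℝ (Fin n))
    {R : Fin n → ℝ} {v : ℝ} (hex : ∀ F, IsFinalClass P F → ∃ q, IsStationaryMeasure P q ∧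
      ∑ i, q i = 1 ∧ ∀ i ∉ F, q i = 0) (m : Fin n → ℝ) (hm : IsStationaryMeasure P m)
    (hv : ∀ F, IsFinalClass P F → (∀ i ∈ F, 0 < m i) → ∀ q, IsStationaryMeasure P q →
      ∑ i, q i = 1 → (∀ i ∉ F, q i = 0) → q ⬝ᵥ R ≤ v) : m ⬝ᵥ R ≤ v * ∑ i, m i := by
  classical
  -- Induction on the size of the support of `m`: a charged state leads to a final class, entirely
  -- charged, and removing the largest multiple of its measure kills at least one point. Only
  -- classes charged by `m` occur, which is why `hv` concerns these alone.
  induction hc : (Finset.univ.filter fun i => 0 < m i).card using Nat.strong_induction_on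
    generalizing m with
  | _ c ih =>
    subst hc
    by_cases h0 : ∃ i, 0 < m i
    · obtain ⟨i, hi⟩ := h0
      obtain ⟨F, hF, hiF⟩ := exists_isFinalClass_hasAccess P i
      obtain ⟨q, hq, hq1, hq0⟩ := hex F hF
      have hmF : ∀ j ∈ F, 0 < m j := fun j hj => hm.pos_of_hasAccess hP hi (hiF j hj)
      obtain ⟨t, ht, htle, k, hk, htk⟩ := exists_smul_le_of_support hF.nonempty hm.1
        (hF.stationary_pos hP hq hq1 hq0) hq0
      have hle : m - t • q ≤ m := sub_le_self _ (smul_nonneg ht hq.1)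
      have := ih _ ?_ (m - t • q) (hm.sub_smul hq htle)
        (fun G hG hpos => hv G hG fun j hj => (hpos j hj).trans_le (hle j)) rfl
      · have hqR := mul_le_mul_of_nonneg_left (hv F hF hmF q hq hq1 hq0) ht
        rw [sub_dotProduct, smul_dotProduct, smul_eq_mul] at this
        simp only [Pi.sub_apply, Pi.smul_apply, smul_eq_mul, Finset.sum_sub_distrib,
          ← Finset.mul_sum, hq1] at this
        linarith
      · refine Finset.card_lt_card ⟨fun j hj => ?_, fun hsub => ?_⟩
        · simp only [Finset.mem_filter, Finset.mem_univ, true_and] at hj ⊢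
          exact hj.trans_le (hle j)
        · have := hsub (Finset.mem_filter.2 ⟨Finset.mem_univ k, hmF k hk⟩)
          simp [htk] at this
    · push Not at h0
      have : m = 0 := le_antisymm h0 hm.1
      simp [this]

/-! ### Cesàro averages -/

/-- The mean occupation measure of the chain `P` started from `i`, up to time `N`. -/
noncomputable def occupation (P : Matrix (Fin n) (Fin n) ℝ) (i : Fin n) (N : ℕ) : Fin n → ℝ :=
  (1 / (N : ℝ)) • ∑ k ∈ Finset.range N, (P ^ k) i

/-- The case `N = 0` is excluded because `1 / 0 = 0` makes the occupation vector zero. -/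
theorem occupation_mem_stdSimplex (hP : P ∈ Matrix.rowStochastic ℝ (Fin n)) (i : Fin n) {N : ℕ}
    (hN : N ≠ 0) : occupation P i N ∈ stdSimplex ℝ (Fin n) := by
  have hk : ∀ k, P ^ k ∈ Matrix.rowStochastic ℝ (Fin n) := fun k => pow_mem hP k
  constructor
  · intro j
    simp only [occupation, Pi.smul_apply, Finset.sum_apply, smul_eq_mul]
    exact mul_nonneg (by positivity) (Finset.sum_nonneg fun k _ => (hk k).1 i j)
  · simp only [occupation, Pi.smul_apply, Finset.sum_apply, smul_eq_mul, ← Finset.mul_sum]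
    rw [Finset.sum_comm]
    simp [Matrix.sum_row_of_mem_rowStochastic (hk _), hN]

/-- The defect of invariance telescopes and is of order `1 / N`; this is what makes cluster points
stationary. -/
theorem occupation_vecMul_sub (P : Matrix (Fin n) (Fin n) ℝ) (i : Fin n) (N : ℕ) :
    occupation P i N ᵥ* P - occupation P i N = (1 / (N : ℝ)) • ((P ^ N) i - (P ^ 0) i) := by
  have h : ∀ k, (P ^ k) i ᵥ* P = (P ^ (k + 1)) i := fun k => by
    rw [pow_succ]; rfl
  rw [occupation, Matrix.smul_vecMul, Matrix.sum_vecMul, ← smul_sub, ← Finset.sum_sub_distrib]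
  simp_rw [h]
  rw [Finset.sum_range_sub fun k => (P ^ k) i]

theorem hasAccess_of_pow_ne_zero {i j : Fin n} {k : ℕ} (h : (P ^ k) i j ≠ 0) :
    HasAccess P i j := by
  induction k generalizing j with
  | zero =>
    have : i = j := by
      by_contra hij
      simp [Matrix.one_apply_ne hij] at h
    exact this ▸ .refl
  | succ k ih =>
    rw [pow_succ, Matrix.mul_apply] at h
    obtain ⟨l, -, hl⟩ := Finset.exists_ne_zero_of_sum_ne_zero h
    exact (ih (left_ne_zero_of_mul hl)).tail (right_ne_zero_of_mul hl)

theorem exists_pow_pos_of_hasAccess (hP : P ∈ Matrix.rowStochastic ℝ (Fin n)) {i j : Fin n}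
    (h : HasAccess P i j) : ∃ k, 0 < (P ^ k) i j := by
  induction h with
  | refl => exact ⟨0, by simp⟩
  | @tail b c _ hbc ih =>
    obtain ⟨k, hk⟩ := ih
    refine ⟨k + 1, ?_⟩
    have h0 : 0 < P b c := lt_of_le_of_ne (hP.1 b c) (Ne.symm hbc)
    rw [pow_succ, Matrix.mul_apply]
    exact (mul_pos hk h0).trans_le (Finset.single_le_sum (f := fun l => (P ^ k) i l * P l c)
      (fun l _ => mul_nonneg ((pow_mem hP k).1 i l) (hP.1 l c)) (Finset.mem_univ b))

theorem occupation_eq_zero {i j : Fin n} (h : ¬ HasAccess P i j) (N : ℕ) :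
    occupation P i N j = 0 := by
  have : ∀ k, (P ^ k) i j = 0 := fun k => by
    by_contra hk
    exact h (hasAccess_of_pow_ne_zero hk)
  simp [occupation, this]

/-- The cluster points of the occupation measures are stationary. -/
theorem isStationaryMeasure_of_tendsto (hP : P ∈ Matrix.rowStochastic ℝ (Fin n)) {i : Fin n}
    {φ : ℕ → ℕ} (hφ : Tendsto φ atTop atTop) {m : Fin n → ℝ}
    (h : Tendsto (fun k => occupation P i (φ k)) atTop (𝓝 m)) :
    IsStationaryMeasure P m ∧ ∑ j, m j = 1 ∧ ∀ j, ¬ HasAccess P i j → m j = 0 := by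
  have hmem : m ∈ stdSimplex ℝ (Fin n) := by
    refine (isClosed_stdSimplex ℝ (Fin n)).mem_of_tendsto h ?_
    filter_upwards [hφ.eventually (eventually_ne_atTop 0)] with k hk
    exact occupation_mem_stdSimplex hP i hk
  refine ⟨⟨hmem.1, ?_⟩, hmem.2, fun j hj => ?_⟩
  · have h1 : Tendsto (fun k => occupation P i (φ k) ᵥ* P - occupation P i (φ k)) atTop
        (𝓝 (m ᵥ* P - m)) := by
      have hc : Continuous fun x : Fin n → ℝ => x ᵥ* P - x := by fun_prop
      exact (hc.tendsto m).comp h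
    have h2 : Tendsto (fun N => occupation P i N ᵥ* P - occupation P i N) atTop (𝓝 0) := by
      simp_rw [occupation_vecMul_sub]
      rw [tendsto_pi_nhds]
      intro j
      have hb : ∀ N : ℕ, |(1 / (N : ℝ)) * ((P ^ N) i j - (P ^ 0) i j)| ≤ 1 / (N : ℝ) := by
        intro N
        rw [abs_mul, abs_of_nonneg (by positivity : (0 : ℝ) ≤ 1 / N)]
        refine mul_le_of_le_one_right (by positivity) ?_
        have e1 := (pow_mem hP N).1 i j
        have e2 := Matrix.le_one_of_mem_rowStochastic (pow_mem hP N) (i := i) (j := j)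
        have e3 := (pow_mem hP 0).1 i j
        have e4 := Matrix.le_one_of_mem_rowStochastic (pow_mem hP 0) (i := i) (j := j)
        rw [abs_le]
        constructor <;> linarith
      exact squeeze_zero_norm hb tendsto_one_div_atTop_nhds_zero_nat
    exact sub_eq_zero.1 (tendsto_nhds_unique h1 (h2.comp hφ))
  · have h1 := ((continuous_apply j).tendsto m).comp h
    refine tendsto_nhds_unique h1 ?_
    simp only [Function.comp_def, occupation_eq_zero hj]
    exact tendsto_const_nhds

theorem exists_subseq_occupation (hP : P ∈ Matrix.rowStochastic ℝ (Fin n)) (i : Fin n)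
    {ψ : ℕ → ℕ} (hψ : Tendsto ψ atTop atTop) :
    ∃ m, ∃ φ : ℕ → ℕ, StrictMono φ ∧
      Tendsto (fun k => occupation P i (ψ (φ k))) atTop (𝓝 m) := by
  obtain ⟨m, -, φ, hφ, h⟩ := (isCompact_stdSimplex ℝ (Fin n)).tendsto_subseq'
    (x := fun k => occupation P i (ψ k))
    ((hψ.eventually (eventually_ne_atTop 0)).mono fun k hk =>
      occupation_mem_stdSimplex hP i hk).frequently
  exact ⟨m, φ, hφ, h⟩

theorem IsFinalClass.exists_stationary (hP : P ∈ Matrix.rowStochastic ℝ (Fin n))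
    {F : Finset (Fin n)} (hF : IsFinalClass P F) :
    ∃ q, IsStationaryMeasure P q ∧ ∑ i, q i = 1 ∧ ∀ i ∉ F, q i = 0 := by
  obtain ⟨i, hi⟩ := hF.nonempty
  obtain ⟨m, φ, hφ, h⟩ := exists_subseq_occupation hP i tendsto_id
  obtain ⟨h1, h2, h3⟩ := isStationaryMeasure_of_tendsto hP hφ.tendsto_atTop h
  exact ⟨m, h1, h2, fun j hj => h3 j fun hij => hj (hF.2 i hi j hij)⟩

/-- Ergodic theorem in a final class. -/
theorem IsFinalClass.tendsto_occupation (hP : P ∈ Matrix.rowStochastic ℝ (Fin n))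
    {F : Finset (Fin n)} (hF : IsFinalClass P F) {i : Fin n} (hi : i ∈ F) {q : Fin n → ℝ}
    (hq : IsStationaryMeasure P q) (hq1 : ∑ i, q i = 1) (hq0 : ∀ i ∉ F, q i = 0) :
    Tendsto (occupation P i) atTop (𝓝 q) := by
  -- By compactness of the simplex, convergence follows once every cluster point is the unique
  -- stationary probability measure carried by `F`.
  refine tendsto_of_subseq_tendsto fun ψ hψ => ?_
  obtain ⟨m, φ, hφ, h⟩ := exists_subseq_occupation hP i hψ
  obtain ⟨h1, h2, h3⟩ := isStationaryMeasure_of_tendsto hP (hψ.comp hφ.tendsto_atTop) h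
  refine ⟨φ, ?_⟩
  rwa [← hF.stationary_unique hP h1 h2 (fun j hj => h3 j fun hij => hj (hF.2 i hi j hij)) hq hq1 hq0]

/-- A lower limit is at most the limit along any subsequence, so one cluster point suffices and
convergence from a transient state is not needed. The cluster point only charges states accessible
from `i`, hence the restriction on the classes in `hv`. -/
theorem liminf_occupation_dotProduct_le (hP : P ∈ Matrix.rowStochastic ℝ (Fin n)) (i : Fin n)
    {R : Fin n → ℝ} {v : ℝ}
    (hv : ∀ F, IsFinalClass P F → (∀ j ∈ F, HasAccess P i j) → ∀ q, IsStationaryMeasure P q →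
      ∑ i, q i = 1 → (∀ i ∉ F, q i = 0) → q ⬝ᵥ R ≤ v) :
    liminf (fun N => ((occupation P i N ⬝ᵥ R : ℝ) : EReal)) atTop ≤ v := by
  obtain ⟨m, φ, hφ, h⟩ := exists_subseq_occupation hP i tendsto_id
  obtain ⟨h1, h2, h3⟩ := isStationaryMeasure_of_tendsto hP hφ.tendsto_atTop h
  have hmv : m ⬝ᵥ R ≤ v := by
    have := IsStationaryMeasure.dotProduct_le hP (R := R) (v := v)
      (fun F hF => hF.exists_stationary hP) m h1
      fun F hF hpos => hv F hF fun j hj => by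
        by_contra hij
        exact (hpos j hj).ne' (h3 j hij)
    simpa [h2] using this
  have hlim : Tendsto (fun k => ((occupation P i (φ k) ⬝ᵥ R : ℝ) : EReal)) atTop
      (𝓝 ((m ⬝ᵥ R : ℝ) : EReal)) := by
    refine (continuous_coe_real_ereal.tendsto _).comp ?_
    have hc : Continuous fun x : Fin n → ℝ => x ⬝ᵥ R := by fun_prop
    exact (hc.tendsto m).comp h
  calc _ ≤ liminf (fun N => ((occupation P i N ⬝ᵥ R : ℝ) : EReal)) (map φ atTop) :=
        liminf_le_liminf_of_le hφ.tendsto_atTop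
    _ = ((m ⬝ᵥ R : ℝ) : EReal) := hlim.liminf_eq
    _ ≤ v := by exact_mod_cast hmv

/-! ### Invariant measures of final classes -/

open Classical in
/-- Extension by zero of a vector indexed by `F`. -/
noncomputable def extendZero (F : Finset (Fin n)) (m : F → ℝ) (i : Fin n) : ℝ :=
  if h : i ∈ F then m ⟨i, h⟩ else 0

theorem extendZero_coe {F : Finset (Fin n)} (m : F → ℝ) (i : F) : extendZero F m i = m i := by
  simp [extendZero]

theorem extendZero_of_notMem {F : Finset (Fin n)} (m : F → ℝ) {i : Fin n} (hi : i ∉ F) :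
    extendZero F m i = 0 := by
  simp [extendZero, hi]

theorem sum_extendZero_mul {F : Finset (Fin n)} (m : F → ℝ) (g : Fin n → ℝ) :
    ∑ i, extendZero F m i * g i = ∑ i : F, m i * g i := by
  rw [← Finset.sum_subset (Finset.subset_univ F)
    fun i _ hi => by rw [extendZero_of_notMem m hi, zero_mul], ← Finset.sum_coe_sort F]
  simp_rw [extendZero_coe]

/-- No mass leaves a final class, so extension by zero keeps invariance at the states outside `F`.
-/
theorem IsFinalClass.isInvariantMeasureOn_iff {F : Finset (Fin n)} (hF : IsFinalClass P F)
    (m : F → ℝ) : IsInvariantMeasureOn P F m ↔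
      IsStationaryMeasure P (extendZero F m) ∧ ∑ i, extendZero F m i = 1 := by
  have hsum : ∑ i, extendZero F m i = ∑ i, m i := by
    simpa using sum_extendZero_mul m fun _ => 1
  have hmul : ∀ j, (extendZero F m ᵥ* P) j = ∑ i : F, m i * P i j := fun j =>
    sum_extendZero_mul m fun i => P i j
  rw [hsum]
  constructor
  · rintro ⟨⟨h0, h1⟩, h2⟩
    refine ⟨⟨fun i => ?_, funext fun j => ?_⟩, h1⟩
    · unfold extendZero
      split_ifs
      exacts [h0 _, le_rfl]
    · rw [hmul]
      by_cases hj : j ∈ F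
      · exact (congrFun h2 ⟨j, hj⟩).trans (extendZero_coe m ⟨j, hj⟩).symm
      · rw [extendZero_of_notMem m hj]
        exact Finset.sum_eq_zero fun i _ => by rw [hF.eq_zero i.2 hj, mul_zero]
  · rintro ⟨⟨h0, h2⟩, h1⟩
    refine ⟨⟨fun i => ?_, h1⟩, funext fun j => ?_⟩
    · rw [← extendZero_coe m i]
      exact h0 i
    · rw [← extendZero_coe m j, ← congrFun h2 j, hmul]
      rfl

theorem IsFinalClass.existsUnique_isInvariantMeasureOn (hP : P ∈ Matrix.rowStochastic ℝ (Fin n))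
    {F : Finset (Fin n)} (hF : IsFinalClass P F) : ∃! m, IsInvariantMeasureOn P F m := by
  obtain ⟨q, hq, hq1, hq0⟩ := hF.exists_stationary hP
  have hext : extendZero F (fun i => q i) = q := by
    funext i
    by_cases hi : i ∈ F
    · exact extendZero_coe _ ⟨i, hi⟩
    · rw [extendZero_of_notMem _ hi, hq0 i hi]
  refine ⟨fun i => q i, (hF.isInvariantMeasureOn_iff _).2 (by rw [hext]; exact ⟨hq, hq1⟩), ?_⟩
  intro m hm
  obtain ⟨h1, h2⟩ := (hF.isInvariantMeasureOn_iff m).1 hm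
  have := hF.stationary_unique hP h1 h2 (fun i hi => extendZero_of_notMem m hi) hq hq1 hq0
  funext i
  rw [← extendZero_coe m i, this]

theorem IsFinalClass.isInvariantMeasureOn_invariantMeasureOn
    (hP : P ∈ Matrix.rowStochastic ℝ (Fin n)) {F : Finset (Fin n)} (hF : IsFinalClass P F) :
    IsInvariantMeasureOn P F (invariantMeasureOn P F) := by
  have h := (hF.existsUnique_isInvariantMeasureOn hP).exists
  rw [invariantMeasureOn, dif_pos h]
  exact h.choose_spec

/-- The invariant measure of a final class, as a measure on all states. -/
noncomputable def finalMeasure (P : Matrix (Fin n) (Fin n) ℝ) (F : Finset (Fin n)) : Fin n → ℝ :=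
  extendZero F (invariantMeasureOn P F)

theorem finalMeasure_eq_zero (P : Matrix (Fin n) (Fin n) ℝ) {F : Finset (Fin n)} :
    ∀ i ∉ F, finalMeasure P F i = 0 :=
  fun _ hi => extendZero_of_notMem _ hi

theorem IsFinalClass.isStationaryMeasure_finalMeasure
    (hP : P ∈ Matrix.rowStochastic ℝ (Fin n)) {F : Finset (Fin n)} (hF : IsFinalClass P F) :
    IsStationaryMeasure P (finalMeasure P F) :=
  ((hF.isInvariantMeasureOn_iff _).1 (hF.isInvariantMeasureOn_invariantMeasureOn hP)).1

theorem IsFinalClass.sum_finalMeasure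
    (hP : P ∈ Matrix.rowStochastic ℝ (Fin n)) {F : Finset (Fin n)} (hF : IsFinalClass P F) :
    ∑ i, finalMeasure P F i = 1 :=
  ((hF.isInvariantMeasureOn_iff _).1 (hF.isInvariantMeasureOn_invariantMeasureOn hP)).2

theorem IsFinalClass.finalMeasure_pos
    (hP : P ∈ Matrix.rowStochastic ℝ (Fin n)) {F : Finset (Fin n)} (hF : IsFinalClass P F) :
    ∀ i ∈ F, 0 < finalMeasure P F i :=
  hF.stationary_pos hP (hF.isStationaryMeasure_finalMeasure hP) (hF.sum_finalMeasure hP)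
    (finalMeasure_eq_zero P)

theorem IsFinalClass.eq_finalMeasure (hP : P ∈ Matrix.rowStochastic ℝ (Fin n))
    {F : Finset (Fin n)} (hF : IsFinalClass P F) {q : Fin n → ℝ} (hq : IsStationaryMeasure P q)
    (hq1 : ∑ i, q i = 1) (hq0 : ∀ i ∉ F, q i = 0) : q = finalMeasure P F :=
  hF.stationary_unique hP hq hq1 hq0 (hF.isStationaryMeasure_finalMeasure hP)
    (hF.sum_finalMeasure hP) (finalMeasure_eq_zero P)

end FiniteChain

/-! ### Marginals of the state-action process -/

theorem ProbabilityTheory.Kernel.map_eval_zero_trajMeasure {E : Type*} [MeasurableSpace E]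
    (μ₀ : Measure E) [IsProbabilityMeasure μ₀]
    (κ : (k : ℕ) → Kernel (Finset.Iic k → E) E) [∀ k, IsMarkovKernel (κ k)] :
    (Kernel.trajMeasure (X := fun _ => E) μ₀ κ).map (fun x => x 0) = μ₀ := by
  let e := MeasurableEquiv.piUnique (fun _ : Finset.Iic 0 => E)
  have h : (Kernel.trajMeasure (X := fun _ => E) μ₀ κ).map (Preorder.frestrictLe 0) =
      μ₀.map e.symm := by
    rw [Kernel.trajMeasure, Measure.map_comp _ _ (by fun_prop), Kernel.traj_map_frestrictLe,
      Kernel.partialTraj_self, Measure.id_comp]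
  have h2 : (fun x : ℕ → E => x 0) = e ∘ Preorder.frestrictLe 0 := rfl
  have hr : Measurable (Preorder.frestrictLe (π := fun _ : ℕ => E) 0) := by fun_prop
  rw [h2, ← Measure.map_map e.measurable hr, h, Measure.map_map e.measurable e.symm.measurable]
  simp

namespace MarkovControlModel

variable {n : ℕ} {A : Type*} [TopologicalSpace A] [MeasurableSpace A] [BorelSpace A]
  {M : MarkovControlModel n A}

instance (γ : M.Strategy) (k : ℕ) (h : Finset.Iic k → Fin n) : IsProbabilityMeasure (γ.law k h) :=
  γ.isProb k h

instance (τ : M.StationaryRule) (i : Fin n) : IsProbabilityMeasure (τ.law i) :=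
  τ.isProb i

instance (γ : M.Strategy) (i : Fin n) : IsProbabilityMeasure (γ.initialLaw i) := by
  unfold Strategy.initialLaw
  infer_instance

instance (γ : M.Strategy) (i : Fin n) : IsProbabilityMeasure (γ.pathMeasure i) := by
  unfold Strategy.pathMeasure
  infer_instance

theorem measurable_reward_uncurry (M : MarkovControlModel n A) :
    Measurable fun p : Fin n × A => M.rewardExt p.1 p.2 := by
  classical
  refine measurable_from_prod_countable_right fun i => ?_
  unfold rewardExt
  exact Measurable.dite (M.measurable_reward i) measurable_const (M.measurableSet_act i)

theorem measurable_rewardExt (M : MarkovControlModel n A) (i : Fin n) :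
    Measurable (M.rewardExt i) :=
  M.measurable_reward_uncurry.comp measurable_prodMk_left

theorem measurable_trans_uncurry (M : MarkovControlModel n A) (j : Fin n) :
    Measurable fun p : Fin n × A => M.transExt p.1 p.2 j :=
  measurable_from_prod_countable_right fun i => M.measurable_transExt i j

theorem transExt_le_one (M : MarkovControlModel n A) (i : Fin n) (a : A) (j : Fin n) :
    M.transExt i a j ≤ 1 := by
  rw [← M.sum_transExt i a]
  exact Finset.single_le_sum (f := fun j => M.transExt i a j)
    (fun j _ => M.transExt_nonneg i a j) (Finset.mem_univ j)

theorem lintegral_stateKernel (M : MarkovControlModel n A) (p : Fin n × A)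
    (g : Fin n → ENNReal) :
    ∫⁻ j, g j ∂M.stateKernel p = ∑ j, ENNReal.ofReal (M.transExt p.1 p.2 j) * g j := by
  change ∫⁻ j, g j ∂(∑ j, ENNReal.ofReal (M.transExt p.1 p.2 j) • Measure.dirac j) = _
  rw [lintegral_finsetSum_measure]
  simp [lintegral_smul_measure]

theorem Strategy.lintegral_stepKernel (γ : M.Strategy) (k : ℕ)
    (h : Finset.Iic k → Fin n × A) {g : Fin n × A → ENNReal} (hg : Measurable g) :
    ∫⁻ y, g y ∂γ.stepKernel k h =
      ∑ j, ENNReal.ofReal (M.transExt (h ⟨k, Finset.mem_Iic.2 le_rfl⟩).1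
        (h ⟨k, Finset.mem_Iic.2 le_rfl⟩).2 j) *
        ∫⁻ a, g (j, a) ∂γ.law (k + 1) (nextHistory k (h, j)) := by
  rw [Strategy.stepKernel, Kernel.lintegral_compProd _ _ _ hg, Kernel.comap_apply,
    lintegral_stateKernel]
  rfl

theorem Strategy.lintegral_pathMeasure_zero (γ : M.Strategy) (i : Fin n)
    {g : Fin n × A → ENNReal} (hg : Measurable g) :
    ∫⁻ ω, g (ω 0) ∂γ.pathMeasure i = ∫⁻ a, g (i, a) ∂γ.law 0 fun _ => i := by
  have h := Kernel.map_eval_zero_trajMeasure (γ.initialLaw i)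
    γ.stepKernel
  calc ∫⁻ ω, g (ω 0) ∂γ.pathMeasure i
      = ∫⁻ y, g y ∂(γ.pathMeasure i).map (fun ω => ω 0) :=
        (lintegral_map hg (measurable_pi_apply 0)).symm
    _ = ∫⁻ y, g y ∂γ.initialLaw i := by rw [Strategy.pathMeasure, h]
    _ = _ := by
      rw [Strategy.initialLaw, lintegral_prod _ hg.aemeasurable, lintegral_dirac]

/-- Disintegration of the path measure over the past up to time `k`. Working with `ENNReal`-valued
functions avoids integrability conditions, which rewards may fail. -/
theorem Strategy.lintegral_pathMeasure_succ (γ : M.Strategy) (i : Fin n) (k : ℕ)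
    {g : Fin n × A → ENNReal} (hg : Measurable g) :
    ∫⁻ ω, g (ω (k + 1)) ∂γ.pathMeasure i =
      ∫⁻ ω, ∑ j, ENNReal.ofReal (M.transExt (ω k).1 (ω k).2 j) *
        ∫⁻ a, g (j, a) ∂γ.law (k + 1) (nextHistory k (Preorder.frestrictLe k ω, j))
        ∂γ.pathMeasure i := by
  have h := Kernel.map_frestrictLe_trajMeasure_compProd_eq_map_trajMeasure
    (X := fun _ => Fin n × A) (μ₀ := γ.initialLaw i) (κ := γ.stepKernel) (a := k)
  have hm : Measurable fun ω : ℕ → Fin n × A => (Preorder.frestrictLe k ω, ω (k + 1)) := by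
    fun_prop
  calc ∫⁻ ω, g (ω (k + 1)) ∂γ.pathMeasure i
      = ∫⁻ y, g y.2 ∂(γ.pathMeasure i).map fun ω => (Preorder.frestrictLe k ω, ω (k + 1)) :=
        (lintegral_map (hg.comp measurable_snd) hm).symm
    _ = ∫⁻ y, g y.2 ∂((γ.pathMeasure i).map (Preorder.frestrictLe k) ⊗ₘ γ.stepKernel k) := by
        rw [Strategy.pathMeasure, h]
    _ = ∫⁻ x, ∫⁻ y, g y ∂γ.stepKernel k x ∂(γ.pathMeasure i).map (Preorder.frestrictLe k) :=
        Measure.lintegral_compProd (hg.comp measurable_snd)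
    _ = ∫⁻ ω, ∫⁻ y, g y ∂γ.stepKernel k (Preorder.frestrictLe k ω) ∂γ.pathMeasure i :=
        lintegral_map (hg.lintegral_kernel) (by fun_prop)
    _ = _ := by
        simp_rw [γ.lintegral_stepKernel k _ hg]
        rfl

/-- The inequality between one-step gains and `dpOperator` is available only for admissible actions;
outside them `rewardExt` and `transExt` take default values. -/
theorem Strategy.ae_mem_act (γ : M.Strategy) (i : Fin n) (k : ℕ) :
    ∀ᵐ ω ∂γ.pathMeasure i, (ω k).2 ∈ M.act (ω k).1 := by
  let s : Set (Fin n × A) := {p | p.2 ∉ M.act p.1}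
  have hs : MeasurableSet s := by
    have : s = ⋃ i, ({i} ×ˢ (M.act i)ᶜ) := by
      ext ⟨j, a⟩
      simp [s]
    rw [this]
    exact MeasurableSet.iUnion fun i => (measurableSet_singleton i).prod (M.measurableSet_act i).compl
  have hg : Measurable (s.indicator (1 : Fin n × A → ENNReal)) := measurable_one.indicator hs
  have hlaw : ∀ k (h : Finset.Iic k → Fin n) j, h ⟨k, Finset.mem_Iic.2 le_rfl⟩ = j →
      ∫⁻ a, s.indicator (1 : Fin n × A → ENNReal) (j, a) ∂γ.law k h = 0 := by
    intro k h j hj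
    have h1 : ∀ a, s.indicator (1 : Fin n × A → ENNReal) (j, a) =
        (M.act j)ᶜ.indicator (1 : A → ENNReal) a := fun a => by
      by_cases ha : a ∈ M.act j <;> simp [s, ha]
    simp_rw [h1]
    rw [lintegral_indicator_one (M.measurableSet_act j).compl, ← hj]
    exact (prob_compl_eq_zero_iff (M.measurableSet_act _)).2 (γ.law_act k h)
  have h0 : ∫⁻ ω, s.indicator (1 : Fin n × A → ENNReal) (ω k) ∂γ.pathMeasure i = 0 := by
    cases k with
    | zero =>
      rw [γ.lintegral_pathMeasure_zero i hg]
      exact hlaw 0 _ i rfl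
    | succ k =>
      rw [γ.lintegral_pathMeasure_succ i k hg]
      have : ∀ (ω : ℕ → Fin n × A) (j : Fin n),
          ∫⁻ a, s.indicator (1 : Fin n × A → ENNReal) (j, a)
            ∂γ.law (k + 1) (nextHistory k (Preorder.frestrictLe k ω, j)) = 0 :=
        fun ω j => hlaw (k + 1) _ j (by simp [nextHistory])
      simp [this]
  have hgk : Measurable fun ω : ℕ → Fin n × A =>
      s.indicator (1 : Fin n × A → ENNReal) (ω k) := hg.comp (measurable_pi_apply k)
  rw [lintegral_eq_zero_iff hgk] at h0
  filter_upwards [h0] with ω hω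
  by_contra h
  have : ω k ∈ s := h
  simp [this] at hω

/-- The expectation of a function of the next state. -/
theorem Strategy.integral_state_succ (γ : M.Strategy) (i : Fin n) (k : ℕ) (u : Fin n → ℝ) :
    ∫ ω, u (ω (k + 1)).1 ∂γ.pathMeasure i =
      ∫ ω, ∑ j, M.transExt (ω k).1 (ω k).2 j * u j ∂γ.pathMeasure i := by
  classical
  have hint : ∀ j, Integrable (fun ω : ℕ → Fin n × A => M.transExt (ω k).1 (ω k).2 j)
      (γ.pathMeasure i) := fun j =>
    Integrable.of_bound ((M.measurable_trans_uncurry j).comp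
      (measurable_pi_apply k)).aestronglyMeasurable 1 (ae_of_all _ fun ω => by
        rw [Real.norm_of_nonneg (M.transExt_nonneg _ _ _)]
        exact M.transExt_le_one _ _ _)
  have hmeas : ∀ j, MeasurableSet {ω : ℕ → Fin n × A | (ω (k + 1)).1 = j} := fun j =>
    (measurable_fst.comp (measurable_pi_apply (k + 1))) (measurableSet_singleton j)
  have hprob : ∀ j, (γ.pathMeasure i).real {ω | (ω (k + 1)).1 = j} =
      ∫ ω, M.transExt (ω k).1 (ω k).2 j ∂γ.pathMeasure i := by
    intro j
    rw [integral_eq_lintegral_of_nonneg_ae (ae_of_all _ fun ω => M.transExt_nonneg _ _ _)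
      (hint j).aestronglyMeasurable, Measure.real]
    congr 1
    -- The test function only sees the next state; the inner integral over actions is then `0` or
    -- the total mass `1` of a strategy law.
    have hg : Measurable (({j} ×ˢ Set.univ : Set (Fin n × A)).indicator
        (1 : Fin n × A → ENNReal)) :=
      measurable_one.indicator ((measurableSet_singleton j).prod .univ)
    have h := γ.lintegral_pathMeasure_succ i k hg
    have e1 : ∀ ω : ℕ → Fin n × A, ({j} ×ˢ Set.univ : Set (Fin n × A)).indicator
        (1 : Fin n × A → ENNReal) (ω (k + 1)) =
        {ω : ℕ → Fin n × A | (ω (k + 1)).1 = j}.indicator 1 ω := fun ω => by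
      by_cases hω : (ω (k + 1)).1 = j <;> simp [Set.indicator, hω]
    simp_rw [e1] at h
    rw [lintegral_indicator_one (hmeas j)] at h
    rw [h]
    refine lintegral_congr fun ω => ?_
    rw [Finset.sum_eq_single j]
    · simp [Set.indicator]
    · intro l _ hl
      simp [Set.indicator, hl]
    · simp
  have e2 : ∀ ω : ℕ → Fin n × A, u (ω (k + 1)).1 =
      ∑ j, {ω : ℕ → Fin n × A | (ω (k + 1)).1 = j}.indicator (fun _ => u j) ω := fun ω => by
    simp [Set.indicator]
  simp_rw [e2]
  rw [integral_finsetSum _ fun j _ => (integrable_const _).indicator (hmeas j),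
    integral_finsetSum _ fun j _ => (hint j).mul_const _]
  refine Finset.sum_congr rfl fun j _ => ?_
  rw [integral_indicator_const _ (hmeas j), hprob, integral_mul_const, smul_eq_mul]

end MarkovControlModel

/-! ### Expectations of random variables bounded from above -/

section ExtMean

variable {Ω : Type*} [MeasurableSpace Ω] {μ : Measure Ω}

theorem extMean_of_integrable {f : Ω → ℝ} (hf : Integrable f μ) :
    extMean μ f = ((∫ ω, f ω ∂μ : ℝ) : EReal) := by
  have h1 : ∫⁻ ω, ENNReal.ofReal (f ω) ∂μ ≠ ⊤ := hf.lintegral_lt_top.ne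
  have h2 : ∫⁻ ω, ENNReal.ofReal (-f ω) ∂μ ≠ ⊤ := hf.neg.lintegral_lt_top.ne
  rw [extMean, integral_eq_lintegral_pos_part_sub_lintegral_neg_part hf, EReal.coe_sub,
    ← EReal.coe_ennreal_toReal h1, ← EReal.coe_ennreal_toReal h2]

/-- The integrable upper bound makes the positive part integrable, so failure of integrability can
only come from an infinite negative part. -/
theorem extMean_eq_bot {f b : Ω → ℝ} (hfm : AEStronglyMeasurable f μ) (hf : ¬ Integrable f μ)
    (hb : Integrable b μ) (h : f ≤ᵐ[μ] b) : extMean μ f = ⊥ := by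
  have h1 : ∫⁻ ω, ENNReal.ofReal (f ω) ∂μ ≠ ⊤ := by
    refine ne_top_of_le_ne_top hb.lintegral_lt_top.ne (lintegral_mono_ae ?_)
    filter_upwards [h] with ω hω using ENNReal.ofReal_le_ofReal hω
  have h2 : ∫⁻ ω, ENNReal.ofReal (-f ω) ∂μ = ⊤ := by
    by_contra h2
    refine hf ⟨hfm, ?_⟩
    have : ∀ ω, ‖f ω‖ₑ ≤ ENNReal.ofReal (f ω) + ENNReal.ofReal (-f ω) := fun ω => by
      rw [← ofReal_norm, Real.norm_eq_abs]
      rcases abs_cases (f ω) with h | h <;> rw [h.1]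
      exacts [le_self_add, le_add_self]
    calc ∫⁻ ω, ‖f ω‖ₑ ∂μ ≤ ∫⁻ ω, (ENNReal.ofReal (f ω) + ENNReal.ofReal (-f ω)) ∂μ :=
          lintegral_mono this
      _ = ∫⁻ ω, ENNReal.ofReal (f ω) ∂μ + ∫⁻ ω, ENNReal.ofReal (-f ω) ∂μ :=
          lintegral_add_left' hfm.aemeasurable.ennreal_ofReal _
      _ < ⊤ := ENNReal.add_lt_top.2 ⟨h1.lt_top, lt_top_iff_ne_top.2 h2⟩
  rw [extMean, h2, EReal.coe_ennreal_top, EReal.sub_top]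

theorem extMean_le_integral {f b : Ω → ℝ} (hfm : AEStronglyMeasurable f μ)
    (hb : Integrable b μ) (h : f ≤ᵐ[μ] b) : extMean μ f ≤ ((∫ ω, b ω ∂μ : ℝ) : EReal) := by
  by_cases hf : Integrable f μ
  · rw [extMean_of_integrable hf]
    exact_mod_cast integral_mono_ae hf hb h
  · rw [extMean_eq_bot hfm hf hb h]
    exact bot_le

/-- If a sum of functions bounded from above is integrable, so is each of them. -/
theorem integrable_of_integrable_sum [IsFiniteMeasure μ] {ι : Type*} {s : Finset ι}
    {f : ι → Ω → ℝ} (hfm : ∀ i, AEStronglyMeasurable (f i) μ) {C : ℝ} (hC : ∀ i ω, f i ω ≤ C)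
    (hs : Integrable (fun ω => ∑ i ∈ s, f i ω) μ) {i : ι} (hi : i ∈ s) : Integrable (f i) μ := by
  -- The functions `C - f i` are nonnegative, so each is dominated by their sum.
  have h1 : Integrable (fun ω => ∑ i ∈ s, (C - f i ω)) μ := by
    simp_rw [Finset.sum_sub_distrib]
    exact (integrable_const _).sub hs
  have h2 : Integrable (fun ω => C - f i ω) μ := by
    refine h1.mono' (aestronglyMeasurable_const.sub (hfm i)) (ae_of_all _ fun ω => ?_)
    rw [Real.norm_of_nonneg (sub_nonneg.2 (hC i ω))]
    exact Finset.single_le_sum (f := fun i => C - f i ω) (fun j _ => sub_nonneg.2 (hC j ω)) hi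
  exact ((integrable_const C).sub h2).congr (ae_of_all _ fun ω => sub_sub_cancel C (f i ω))

end ExtMean

/-! ### Upper bound on the mean reward of arbitrary strategies. -/

namespace MarkovControlModel

variable {n : ℕ} {A : Type*} [TopologicalSpace A] [MeasurableSpace A] [BorelSpace A]
  {M : MarkovControlModel n A}

/-- Attainment at `x = 0` bounds each reward by its maximum. Absolute values make the common bound
also dominate the default value `0`. -/
theorem exists_reward_le (M : MarkovControlModel n A) : ∃ C, ∀ i a, M.rewardExt i a ≤ C := by
  choose a ha using fun i => M.attained i 0
  refine ⟨∑ i, |M.reward i (a i)|, fun i b => ?_⟩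
  have h1 : |M.reward i (a i)| ≤ ∑ i, |M.reward i (a i)| :=
    Finset.single_le_sum (f := fun i => |M.reward i (a i)|) (fun i _ => abs_nonneg _)
      (Finset.mem_univ i)
  unfold rewardExt
  split_ifs with hb
  · have := ha i ⟨b, hb⟩
    simp only [Pi.zero_apply, mul_zero, Finset.sum_const_zero, add_zero] at this
    exact this.trans ((le_abs_self _).trans h1)
  · exact (abs_nonneg _).trans h1

theorem reward_add_le_dpOperator (M : MarkovControlModel n A) (x : Fin n → ℝ) (i : Fin n) {a : A}
    (ha : a ∈ M.act i) :
    M.rewardExt i a + ∑ j, M.transExt i a j * x j ≤ M.dpOperator x i := by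
  obtain ⟨b, hb⟩ := M.attained i x
  simp only [rewardExt, transExt, dif_pos ha]
  exact le_ciSup (f := fun a : M.act i => M.reward i a + ∑ j, M.trans i a j * x j)
    ⟨_, by rintro _ ⟨c, rfl⟩; exact hb c⟩ ⟨a, ha⟩

theorem exists_eq_dpOperator (M : MarkovControlModel n A) (x : Fin n → ℝ) (i : Fin n) :
    ∃ a ∈ M.act i, M.rewardExt i a + ∑ j, M.transExt i a j * x j = M.dpOperator x i := by
  obtain ⟨b, hb⟩ := M.attained i x
  refine ⟨b, b.2, (M.reward_add_le_dpOperator x i b.2).antisymm ?_⟩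
  simp only [rewardExt, transExt, dif_pos b.2]
  have : Nonempty (M.act i) := ⟨b⟩
  exact ciSup_le hb

theorem Strategy.integrable_path_of_bounded (γ : M.Strategy) (i : Fin n) (k : ℕ)
    {g : Fin n × A → ℝ} (hg : Measurable g) {C : ℝ} (hC : ∀ p, |g p| ≤ C) :
    Integrable (fun ω => g (ω k)) (γ.pathMeasure i) :=
  Integrable.of_bound (hg.comp (measurable_pi_apply k)).aestronglyMeasurable C
    (ae_of_all _ fun _ => hC _)

theorem measurable_path_reward (M : MarkovControlModel n A) (k : ℕ) :
    Measurable fun ω : ℕ → Fin n × A => M.rewardExt (ω k).1 (ω k).2 :=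
  M.measurable_reward_uncurry.comp (measurable_pi_apply k)

theorem measurable_path_reward_sum (M : MarkovControlModel n A) (N : ℕ) :
    Measurable fun ω : ℕ → Fin n × A =>
      ∑ k ∈ Finset.range N, M.rewardExt (ω k).1 (ω k).2 :=
  Finset.measurable_sum _ fun k _ => M.measurable_path_reward k

theorem abs_le_sum_abs (u : Fin n → ℝ) (i : Fin n) : |u i| ≤ ∑ j, |u j| :=
  Finset.single_le_sum (f := fun j => |u j|) (fun _ _ => abs_nonneg _) (Finset.mem_univ i)

theorem abs_sum_transExt_mul_le (M : MarkovControlModel n A) (u : Fin n → ℝ) (i : Fin n)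
    (a : A) : |∑ j, M.transExt i a j * u j| ≤ ∑ j, |u j| := by
  refine (Finset.abs_sum_le_sum_abs _ _).trans (Finset.sum_le_sum fun j _ => ?_)
  rw [abs_mul, abs_of_nonneg (M.transExt_nonneg i a j)]
  exact mul_le_of_le_one_left (abs_nonneg _) (M.transExt_le_one i a j)

theorem measurable_trans_dot (M : MarkovControlModel n A) (u : Fin n → ℝ) :
    Measurable fun p : Fin n × A => ∑ j, M.transExt p.1 p.2 j * u j :=
  Finset.measurable_sum _ fun j _ => (M.measurable_trans_uncurry j).mul_const _

theorem Strategy.integrable_state (γ : M.Strategy) (i : Fin n) (k : ℕ) (u : Fin n → ℝ) :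
    Integrable (fun ω : ℕ → Fin n × A => u (ω k).1) (γ.pathMeasure i) :=
  γ.integrable_path_of_bounded i k (g := fun p => u p.1)
    ((measurable_of_countable u).comp measurable_fst) fun p => abs_le_sum_abs u p.1

theorem Strategy.integrable_trans (γ : M.Strategy) (i : Fin n) (k : ℕ) (u : Fin n → ℝ) :
    Integrable (fun ω : ℕ → Fin n × A => ∑ j, M.transExt (ω k).1 (ω k).2 j * u j)
      (γ.pathMeasure i) :=
  γ.integrable_path_of_bounded i k (g := fun p => ∑ j, M.transExt p.1 p.2 j * u j)
    (M.measurable_trans_dot u) fun p => M.abs_sum_transExt_mul_le u p.1 p.2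

theorem Strategy.integrable_drift (γ : M.Strategy) (i : Fin n) (k : ℕ) (u : Fin n → ℝ)
    (lam : ℝ) : Integrable (fun ω : ℕ → Fin n × A =>
      lam + u (ω k).1 - ∑ j, M.transExt (ω k).1 (ω k).2 j * u j) (γ.pathMeasure i) :=
  ((integrable_const lam).add (γ.integrable_state i k u)).sub (γ.integrable_trans i k u)

theorem Strategy.integral_drift (γ : M.Strategy) (i : Fin n) (k : ℕ) (u : Fin n → ℝ)
    (lam : ℝ) : ∫ ω, (lam + u (ω k).1 - ∑ j, M.transExt (ω k).1 (ω k).2 j * u j)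
      ∂γ.pathMeasure i = lam - (∫ ω, u (ω (k + 1)).1 ∂γ.pathMeasure i -
        ∫ ω, u (ω k).1 ∂γ.pathMeasure i) := by
  have h1 := integral_sub ((integrable_const lam).add (γ.integrable_state i k u))
    (γ.integrable_trans i k u)
  have h2 := integral_add (integrable_const (μ := γ.pathMeasure i) lam)
    (γ.integrable_state i k u)
  simp only [Pi.add_apply, integral_const, probReal_univ, one_smul] at h1 h2
  rw [h1, h2, γ.integral_state_succ]
  ring

theorem Strategy.abs_integral_state_le (γ : M.Strategy) (i : Fin n) (k : ℕ) (u : Fin n → ℝ) :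
    |∫ ω, u (ω k).1 ∂γ.pathMeasure i| ≤ ∑ j, |u j| := by
  have := norm_integral_le_of_norm_le_const (μ := γ.pathMeasure i)
    (f := fun ω : ℕ → Fin n × A => u (ω k).1) (C := ∑ j, |u j|)
    (ae_of_all _ fun ω => abs_le_sum_abs u (ω k).1)
  rwa [probReal_univ, mul_one] at this

/-- Almost surely each reward is at most the drift `lam + u(ξ_k) - (P u)(ξ_k, α_k)`. The expected
drifts telescope, and each of the two boundary terms is at most `∑ j, |u j|`. -/
theorem Strategy.extMean_sum_reward_le (γ : M.Strategy) (i : Fin n) {u : Fin n → ℝ} {lam : ℝ}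
    (hu : ∀ i, ∀ a ∈ M.act i, M.rewardExt i a + ∑ j, M.transExt i a j * u j ≤ lam + u i)
    (N : ℕ) : extMean (γ.pathMeasure i)
      (fun ω => ∑ k ∈ Finset.range N, M.rewardExt (ω k).1 (ω k).2) ≤
        ((N * lam + 2 * ∑ j, |u j| : ℝ) : EReal) := by
  refine (extMean_le_integral (M.measurable_path_reward_sum N).aestronglyMeasurable
    (b := fun ω => ∑ k ∈ Finset.range N,
      (lam + u (ω k).1 - ∑ j, M.transExt (ω k).1 (ω k).2 j * u j))
    (integrable_finsetSum _ fun k _ => γ.integrable_drift i k u lam) ?_).trans ?_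
  · filter_upwards [ae_all_iff.2 (γ.ae_mem_act i)] with ω hω
    refine Finset.sum_le_sum fun k _ => ?_
    have := hu _ _ (hω k)
    linarith
  · rw [integral_finsetSum _ fun k _ => γ.integrable_drift i k u lam]
    simp_rw [γ.integral_drift]
    rw [Finset.sum_sub_distrib, Finset.sum_range_sub fun k => ∫ ω, u (ω k).1 ∂γ.pathMeasure i,
      EReal.coe_le_coe_iff, Finset.sum_const, Finset.card_range, nsmul_eq_mul]
    have h1 := abs_le.1 (γ.abs_integral_state_le i 0 u)
    have h2 := abs_le.1 (γ.abs_integral_state_le i N u)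
    linarith

/-- An additive super-eigenvector bounds the mean reward of all strategies. -/
theorem Strategy.meanReward_le (γ : M.Strategy) (i : Fin n) {u : Fin n → ℝ} {lam : ℝ}
    (hu : ∀ i, ∀ a ∈ M.act i, M.rewardExt i a + ∑ j, M.transExt i a j * u j ≤ lam + u i) :
    γ.meanReward i ≤ lam := by
  set B : ℝ := ∑ j, |u j| with hB
  have hlim : Tendsto (fun N : ℕ => ((lam + 2 * B * (1 / (N : ℝ)) : ℝ) : EReal)) atTop
      (𝓝 (lam : EReal)) := by
    refine (continuous_coe_real_ereal.tendsto lam).comp ?_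
    simpa using (tendsto_one_div_atTop_nhds_zero_nat (𝕜 := ℝ)).const_mul (2 * B) |>.const_add lam
  rw [← hlim.liminf_eq]
  refine liminf_le_liminf ?_
  filter_upwards [eventually_ne_atTop 0] with N hN
  have hpos : (0 : EReal) ≤ ((1 / (N : ℝ) : ℝ) : EReal) := by
    exact_mod_cast (by positivity : (0 : ℝ) ≤ 1 / N)
  refine (mul_le_mul_of_nonneg_left (γ.extMean_sum_reward_le i hu N) hpos).trans ?_
  rw [← EReal.coe_mul, ← hB]
  have hN' : (N : ℝ) ≠ 0 := by exact_mod_cast hN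
  refine le_of_eq (congrArg _ ?_)
  field_simp

end MarkovControlModel

namespace MarkovControlModel

variable {n : ℕ} {A : Type*} [TopologicalSpace A] [MeasurableSpace A] [BorelSpace A]
  {M : MarkovControlModel n A}

/-! ### Stationary strategies -/

namespace StationaryRule

theorem ae_mem_act (τ : M.StationaryRule) (i : Fin n) : ∀ᵐ a ∂τ.law i, a ∈ M.act i :=
  (prob_compl_eq_zero_iff (M.measurableSet_act i)).2 (τ.law_act i)

theorem integrable_transExt (τ : M.StationaryRule) (i j : Fin n) :
    Integrable (fun a => M.transExt i a j) (τ.law i) :=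
  Integrable.of_bound (M.measurable_transExt i j).aestronglyMeasurable 1 (ae_of_all _ fun a => by
    rw [Real.norm_of_nonneg (M.transExt_nonneg _ _ _)]
    exact M.transExt_le_one _ _ _)

theorem transMatrix_mem_rowStochastic (τ : M.StationaryRule) :
    τ.transMatrix ∈ Matrix.rowStochastic ℝ (Fin n) := by
  rw [Matrix.mem_rowStochastic_iff_sum]
  refine ⟨fun i j => integral_nonneg fun a => M.transExt_nonneg i a j, fun i => ?_⟩
  simp only [transMatrix]
  rw [← integral_finsetSum _ fun j _ => τ.integrable_transExt i j]
  simp [M.sum_transExt]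

theorem transMatrix_mulVec (τ : M.StationaryRule) (x : Fin n → ℝ) (i : Fin n) :
    (τ.transMatrix *ᵥ x) i = ∫ a, ∑ j, M.transExt i a j * x j ∂τ.law i := by
  rw [integral_finsetSum _ fun j _ => (τ.integrable_transExt i j).mul_const _]
  simp_rw [integral_mul_const]
  rfl

theorem lintegral_transExt (τ : M.StationaryRule) (i j : Fin n) :
    ∫⁻ a, ENNReal.ofReal (M.transExt i a j) ∂τ.law i = ENNReal.ofReal (τ.transMatrix i j) :=
  (ofReal_integral_eq_lintegral_ofReal (τ.integrable_transExt i j)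
    (ae_of_all _ fun a => M.transExt_nonneg i a j)).symm

theorem lintegral_pathMeasure (τ : M.StationaryRule) (i : Fin n) (k : ℕ)
    {g : Fin n × A → ENNReal} (hg : Measurable g) :
    ∫⁻ ω, g (ω k) ∂τ.toStrategy.pathMeasure i =
      ∑ j, ENNReal.ofReal ((τ.transMatrix ^ k) i j) * ∫⁻ a, g (j, a) ∂τ.law j := by
  have hP := τ.transMatrix_mem_rowStochastic
  induction k generalizing g with
  | zero =>
    rw [Strategy.lintegral_pathMeasure_zero _ _ hg, Finset.sum_eq_single i]
    · simp [toStrategy]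
    · intro j _ hj
      simp [Matrix.one_apply_ne hj.symm]
    · simp
  | succ k ih =>
    rw [Strategy.lintegral_pathMeasure_succ _ _ _ hg]
    have hlaw : ∀ (ω : ℕ → Fin n × A) (j : Fin n), τ.toStrategy.law (k + 1)
        (nextHistory k (Preorder.frestrictLe k ω, j)) = τ.law j := fun ω j => by
      simp [toStrategy, nextHistory]
    simp_rw [hlaw]
    -- A stationary rule forgets the past, so the one-step conditional expectation of `g` is again a
    -- function of the current pair, to which the induction hypothesis applies.
    have hstep := ih (g := fun p => ∑ j, ENNReal.ofReal (M.transExt p.1 p.2 j) *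
      ∫⁻ a, g (j, a) ∂τ.law j) (Finset.measurable_sum _ fun j _ =>
        (M.measurable_trans_uncurry j).ennreal_ofReal.mul_const _)
    rw [hstep]
    have hin : ∀ l, ∫⁻ a, ∑ j, ENNReal.ofReal (M.transExt l a j) * ∫⁻ a, g (j, a) ∂τ.law j
        ∂τ.law l = ∑ j, ENNReal.ofReal (τ.transMatrix l j) * ∫⁻ a, g (j, a) ∂τ.law j := by
      intro l
      rw [lintegral_finsetSum _ fun j _ => (M.measurable_transExt l j).ennreal_ofReal.mul_const _]
      refine Finset.sum_congr rfl fun j _ => ?_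
      rw [lintegral_mul_const _ (M.measurable_transExt l j).ennreal_ofReal, τ.lintegral_transExt]
    simp_rw [hin, Finset.mul_sum]
    rw [Finset.sum_comm]
    refine Finset.sum_congr rfl fun j _ => ?_
    simp_rw [← mul_assoc]
    rw [← Finset.sum_mul, pow_succ, Matrix.mul_apply, ENNReal.ofReal_sum_of_nonneg]
    · simp_rw [ENNReal.ofReal_mul ((pow_mem hP k).1 i _)]
    · exact fun l _ => mul_nonneg ((pow_mem hP k).1 i l) (hP.1 l j)

/-- The law of the state-action pair at time `k`. -/
theorem map_pathMeasure (τ : M.StationaryRule) (i : Fin n) (k : ℕ) :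
    (τ.toStrategy.pathMeasure i).map (fun ω => ω k) =
      ∑ j, ENNReal.ofReal ((τ.transMatrix ^ k) i j) • (τ.law j).map (Prod.mk j) := by
  refine Measure.ext_of_lintegral _ fun g hg => ?_
  rw [lintegral_map hg (measurable_pi_apply k), τ.lintegral_pathMeasure i k hg,
    lintegral_finsetSum_measure]
  refine Finset.sum_congr rfl fun j _ => ?_
  rw [lintegral_smul_measure, lintegral_map hg measurable_prodMk_left, smul_eq_mul]

theorem integrable_path_reward_iff (τ : M.StationaryRule) (i : Fin n) (k : ℕ) :
    Integrable (fun ω : ℕ → Fin n × A => M.rewardExt (ω k).1 (ω k).2)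
      (τ.toStrategy.pathMeasure i) ↔
      ∀ j, 0 < (τ.transMatrix ^ k) i j → Integrable (M.rewardExt j) (τ.law j) := by
  have hg := M.measurable_reward_uncurry
  have h1 := integrable_map_measure (μ := τ.toStrategy.pathMeasure i) (f := fun ω => ω k)
    hg.aestronglyMeasurable (measurable_pi_apply k).aemeasurable
  change Integrable ((fun p : Fin n × A => M.rewardExt p.1 p.2) ∘
    fun ω : ℕ → Fin n × A => ω k) _ ↔ _
  rw [← h1, τ.map_pathMeasure, integrable_finsetSum_measure]
  refine forall_congr' fun j => ?_
  have h2 : Integrable (fun p : Fin n × A => M.rewardExt p.1 p.2) ((τ.law j).map (Prod.mk j)) ↔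
      Integrable (M.rewardExt j) (τ.law j) :=
    integrable_map_measure hg.aestronglyMeasurable measurable_prodMk_left.aemeasurable
  rw [← h2]
  by_cases hj : 0 < (τ.transMatrix ^ k) i j
  · simp [hj, integrable_smul_measure (ENNReal.ofReal_pos.2 hj).ne' ENNReal.ofReal_ne_top]
  · simp [hj, ENNReal.ofReal_of_nonpos (not_lt.1 hj)]

/-- The expected reward in state `i`, as a real number (meaningful if it is not `-∞`). -/
noncomputable def meanRewardReal (τ : M.StationaryRule) (i : Fin n) : ℝ :=
  ∫ a, M.rewardExt i a ∂τ.law i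

theorem integral_path_reward (τ : M.StationaryRule) (i : Fin n) (k : ℕ)
    (h : Integrable (fun ω : ℕ → Fin n × A => M.rewardExt (ω k).1 (ω k).2)
      (τ.toStrategy.pathMeasure i)) :
    ∫ ω, M.rewardExt (ω k).1 (ω k).2 ∂τ.toStrategy.pathMeasure i =
      (τ.transMatrix ^ k) i ⬝ᵥ τ.meanRewardReal := by
  have hg := M.measurable_reward_uncurry
  have h1 := integral_map (μ := τ.toStrategy.pathMeasure i) (φ := fun ω => ω k)
    (measurable_pi_apply k).aemeasurable hg.aestronglyMeasurable
  have h2 := (integrable_map_measure (μ := τ.toStrategy.pathMeasure i) (f := fun ω => ω k)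
    hg.aestronglyMeasurable (measurable_pi_apply k).aemeasurable).2 h
  rw [τ.map_pathMeasure, integrable_finsetSum_measure] at h2
  rw [← h1, τ.map_pathMeasure, integral_finsetSum_measure h2]
  refine Finset.sum_congr rfl fun j _ => ?_
  rw [integral_smul_measure, integral_map measurable_prodMk_left.aemeasurable
    hg.aestronglyMeasurable, ENNReal.toReal_ofReal
    ((pow_mem τ.transMatrix_mem_rowStochastic k).1 i j), smul_eq_mul]
  rfl

theorem meanRewardVector_of_integrable (τ : M.StationaryRule) {i : Fin n}
    (h : Integrable (M.rewardExt i) (τ.law i)) :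
    τ.meanRewardVector i = (τ.meanRewardReal i : EReal) :=
  extMean_of_integrable h

theorem meanRewardVector_of_not_integrable (τ : M.StationaryRule) {i : Fin n}
    (h : ¬ Integrable (M.rewardExt i) (τ.law i)) : τ.meanRewardVector i = ⊥ := by
  obtain ⟨C, hC⟩ := M.exists_reward_le
  exact extMean_eq_bot (M.measurable_rewardExt i).aestronglyMeasurable h (integrable_const C)
    (ae_of_all _ (hC i))

/-- The mean reward is the limit inferior of the averages of the mean rewards with respect to the
occupation measures. -/
theorem meanReward_eq_liminf (τ : M.StationaryRule) {i : Fin n}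
    (h : ∀ j, HasAccess τ.transMatrix i j → Integrable (M.rewardExt j) (τ.law j)) :
    τ.toStrategy.meanReward i = liminf
      (fun N => ((occupation τ.transMatrix i N ⬝ᵥ τ.meanRewardReal : ℝ) : EReal)) atTop := by
  have hint : ∀ k, Integrable (fun ω : ℕ → Fin n × A => M.rewardExt (ω k).1 (ω k).2)
      (τ.toStrategy.pathMeasure i) := fun k =>
    (τ.integrable_path_reward_iff i k).2 fun j hj => h j (hasAccess_of_pow_ne_zero hj.ne')
  unfold Strategy.meanReward
  congr 1
  funext N
  rw [extMean_of_integrable (integrable_finsetSum _ fun k _ => hint k),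
    integral_finsetSum _ fun k _ => hint k, ← EReal.coe_mul]
  simp_rw [fun k => τ.integral_path_reward i k (hint k)]
  rw [occupation, smul_dotProduct, sum_dotProduct, smul_eq_mul]

/-- The state `j` is charged at some time `k`. For every horizon beyond `k` the total reward,
bounded above, contains a non-integrable term, so its expectation is already `-∞`. -/
theorem meanReward_eq_bot (τ : M.StationaryRule) {i j : Fin n}
    (hij : HasAccess τ.transMatrix i j) (hj : ¬ Integrable (M.rewardExt j) (τ.law j)) :
    τ.toStrategy.meanReward i = ⊥ := by
  obtain ⟨C, hC⟩ := M.exists_reward_le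
  obtain ⟨k, hk⟩ := exists_pow_pos_of_hasAccess τ.transMatrix_mem_rowStochastic hij
  have hev : ∀ᶠ N : ℕ in atTop, ((1 / (N : ℝ) : ℝ) : EReal) *
      extMean (τ.toStrategy.pathMeasure i)
        (fun ω => ∑ k ∈ Finset.range N, M.rewardExt (ω k).1 (ω k).2) = ⊥ := by
    filter_upwards [eventually_gt_atTop k] with N hN
    rw [extMean_eq_bot (M.measurable_path_reward_sum N).aestronglyMeasurable
      (b := fun _ => ∑ k ∈ Finset.range N, C) ?_ (integrable_const _)
      (ae_of_all _ fun ω => Finset.sum_le_sum fun k _ => hC _ _)]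
    · refine EReal.coe_mul_bot_of_pos ?_
      have : (0 : ℝ) < N := by exact_mod_cast (Nat.zero_le k).trans_lt hN
      positivity
    · intro hs
      have := integrable_of_integrable_sum
        (f := fun k (ω : ℕ → Fin n × A) => M.rewardExt (ω k).1 (ω k).2)
        (fun k => (M.measurable_path_reward k).aestronglyMeasurable) (fun k ω => hC _ _) hs
        (Finset.mem_range.2 hN)
      exact hj ((τ.integrable_path_reward_iff i k).1 this j hk)
  unfold Strategy.meanReward
  rw [liminf_congr hev, liminf_const]

theorem _root_.EReal.coe_finsetSum {ι : Type*} (s : Finset ι) (f : ι → ℝ) :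
    ((∑ i ∈ s, f i : ℝ) : EReal) = ∑ i ∈ s, (f i : EReal) :=
  map_sum (⟨⟨Real.toEReal, EReal.coe_zero⟩, EReal.coe_add⟩ : ℝ →+ EReal) f s

theorem classReward_of_integrable (τ : M.StationaryRule) {F : Finset (Fin n)}
    (h : ∀ i ∈ F, Integrable (M.rewardExt i) (τ.law i)) :
    τ.classReward F = ((finalMeasure τ.transMatrix F ⬝ᵥ τ.meanRewardReal : ℝ) : EReal) := by
  rw [classReward, finalMeasure, dotProduct, sum_extendZero_mul, EReal.coe_finsetSum]
  refine Finset.sum_congr rfl fun i _ => ?_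
  rw [τ.meanRewardVector_of_integrable (h i i.2), EReal.coe_mul]

/-- Strict positivity of the invariant measure on `F` is essential: in `EReal`, `0 * ⊥ = 0`. -/
theorem classReward_eq_bot (τ : M.StationaryRule) {F : Finset (Fin n)}
    (hF : IsFinalClass τ.transMatrix F) {i : Fin n} (hi : i ∈ F)
    (h : ¬ Integrable (M.rewardExt i) (τ.law i)) : τ.classReward F = ⊥ := by
  classical
  have hpos := hF.finalMeasure_pos τ.transMatrix_mem_rowStochastic i hi
  rw [finalMeasure, extendZero_coe _ ⟨i, hi⟩] at hpos
  rw [classReward, ← Finset.add_sum_erase _ _ (Finset.mem_univ (⟨i, hi⟩ : F)),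
    τ.meanRewardVector_of_not_integrable h, EReal.coe_mul_bot_of_pos hpos, EReal.bot_add]

theorem integrable_of_classReward_ne_bot (τ : M.StationaryRule) {F : Finset (Fin n)}
    (hF : IsFinalClass τ.transMatrix F) (h : τ.classReward F ≠ ⊥) :
    ∀ i ∈ F, Integrable (M.rewardExt i) (τ.law i) := by
  intro i hi
  by_contra hint
  exact h (τ.classReward_eq_bot hF hi hint)

theorem classReward_ne_top (τ : M.StationaryRule) {F : Finset (Fin n)}
    (hF : IsFinalClass τ.transMatrix F) : τ.classReward F ≠ ⊤ := by
  by_cases h : τ.classReward F = ⊥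
  · simp [h]
  · rw [τ.classReward_of_integrable (τ.integrable_of_classReward_ne_bot hF h)]
    exact EReal.coe_ne_top _

/-- From a state of `F` exactly the states of `F` are accessible. If all their rewards are
integrable, the ergodic theorem applies; otherwise both sides are `-∞`. -/
theorem meanReward_eq_classReward (τ : M.StationaryRule) {F : Finset (Fin n)}
    (hF : IsFinalClass τ.transMatrix F) {i : Fin n} (hi : i ∈ F) :
    τ.toStrategy.meanReward i = τ.classReward F := by
  have hP := τ.transMatrix_mem_rowStochastic
  by_cases h : ∀ j ∈ F, Integrable (M.rewardExt j) (τ.law j)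
  · rw [τ.classReward_of_integrable h, τ.meanReward_eq_liminf fun j hj => h j (hF.2 i hi j hj)]
    refine Tendsto.liminf_eq ((continuous_coe_real_ereal.tendsto _).comp ?_)
    have hc : Continuous fun x : Fin n → ℝ => x ⬝ᵥ τ.meanRewardReal := by fun_prop
    exact (hc.tendsto _).comp (hF.tendsto_occupation hP hi
      (hF.isStationaryMeasure_finalMeasure hP) (hF.sum_finalMeasure hP) (finalMeasure_eq_zero _))
  · push Not at h
    obtain ⟨j, hj, hint⟩ := h
    rw [τ.classReward_eq_bot hF hj hint, τ.meanReward_eq_bot (hF.hasAccess hi hj) hint]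

theorem exists_isGreatest (τ : M.StationaryRule) (hn : 0 < n) :
    ∃ F, IsFinalClass τ.transMatrix F ∧
      IsGreatest (Set.range fun i : Fin n => τ.toStrategy.meanReward i) (τ.classReward F) ∧
      IsGreatest (τ.classReward '' {F | IsFinalClass τ.transMatrix F}) (τ.classReward F) := by
  have hP := τ.transMatrix_mem_rowStochastic
  obtain ⟨F, hF, hmax⟩ := Set.exists_max_image {F | IsFinalClass τ.transMatrix F} τ.classReward
    (Set.toFinite _) (by
      obtain ⟨F, hF, -⟩ := exists_isFinalClass_hasAccess τ.transMatrix ⟨0, hn⟩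
      exact ⟨F, hF⟩)
  refine ⟨F, hF, ⟨?_, ?_⟩, ⟨F, hF, rfl⟩, ?_⟩
  · obtain ⟨i, hi⟩ := hF.nonempty
    exact ⟨i, τ.meanReward_eq_classReward hF hi⟩
  · rintro _ ⟨i, rfl⟩
    by_cases h : ∀ j, HasAccess τ.transMatrix i j → Integrable (M.rewardExt j) (τ.law j)
    · obtain ⟨G, hG, hiG⟩ := exists_isFinalClass_hasAccess τ.transMatrix i
      -- The class `G` reached from `i` has a finite reward, so the maximal class reward is finite
      -- and can be treated as a real bound.
      have hbot : τ.classReward F ≠ ⊥ := by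
        have := hmax G hG
        rw [τ.classReward_of_integrable fun j hj => h j (hiG j hj)] at this
        exact ((EReal.bot_lt_coe _).trans_le this).ne'
      change τ.toStrategy.meanReward i ≤ _
      rw [τ.meanReward_eq_liminf h, ← EReal.coe_toReal (τ.classReward_ne_top hF) hbot]
      refine liminf_occupation_dotProduct_le hP i fun H hH hiH q hq hq1 hq0 => ?_
      have := hmax H hH
      rw [τ.classReward_of_integrable fun j hj => h j (hiH j hj),
        ← EReal.coe_toReal (τ.classReward_ne_top hF) hbot] at this
      rw [hH.eq_finalMeasure hP hq hq1 hq0]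
      exact_mod_cast this
    · push Not at h
      obtain ⟨j, hij, hint⟩ := h
      simp [τ.meanReward_eq_bot hij hint]
  · rintro _ ⟨G, hG, rfl⟩
    exact hmax G hG

/-! ### The spectral equation restricted to a final class, and finitely supported rules. -/

/-- If the rule `τ` attains the maximum in the spectral equation on the final class `F`, the mean
reward on this class is the eigenvalue. -/
theorem classReward_eq_of_eigen (τ : M.StationaryRule) {F : Finset (Fin n)}
    (hF : IsFinalClass τ.transMatrix F) {u : Fin n → ℝ} {lam : ℝ}
    (hint : ∀ i ∈ F, Integrable (M.rewardExt i) (τ.law i))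
    (h : ∀ i ∈ F, τ.meanRewardReal i + (τ.transMatrix *ᵥ u) i = lam + u i) :
    τ.classReward F = lam := by
  have hP := τ.transMatrix_mem_rowStochastic
  rw [τ.classReward_of_integrable hint, EReal.coe_eq_coe_iff]
  set q := finalMeasure τ.transMatrix F
  -- After pairing with `q`, invariance `q P = q` makes the two occurrences of `u` cancel.
  have h1 : q ⬝ᵥ (τ.meanRewardReal + τ.transMatrix *ᵥ u) = q ⬝ᵥ ((fun _ => lam) + u) := by
    refine Finset.sum_congr rfl fun i _ => ?_
    by_cases hi : i ∈ F
    · exact congrArg (q i * ·) (h i hi)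
    · simp only [q, finalMeasure_eq_zero _ i hi, zero_mul]
  rw [dotProduct_add, dotProduct_add, Matrix.dotProduct_mulVec,
    (hF.isStationaryMeasure_finalMeasure hP).2] at h1
  have h2 : q ⬝ᵥ (fun _ => lam) = lam := by
    simp only [dotProduct]
    rw [← Finset.sum_mul, hF.sum_finalMeasure hP, one_mul]
  linarith

/-- Conversely, if the mean reward on the final class `F` is the eigenvalue, then the maximum in
the spectral equation is attained on `F`. -/
theorem eigen_of_classReward_eq (τ : M.StationaryRule) {F : Finset (Fin n)}
    (hF : IsFinalClass τ.transMatrix F) {u : Fin n → ℝ} {lam : ℝ}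
    (hint : ∀ i ∈ F, Integrable (M.rewardExt i) (τ.law i))
    (hle : ∀ i ∈ F, τ.meanRewardReal i + (τ.transMatrix *ᵥ u) i ≤ lam + u i)
    (h : τ.classReward F = lam) :
    ∀ i ∈ F, τ.meanRewardReal i + (τ.transMatrix *ᵥ u) i = lam + u i := by
  have hP := τ.transMatrix_mem_rowStochastic
  have hst := hF.isStationaryMeasure_finalMeasure hP
  rw [τ.classReward_of_integrable hint, EReal.coe_eq_coe_iff] at h
  set q := finalMeasure τ.transMatrix F
  have h2 : q ⬝ᵥ (fun _ => lam) = lam := by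
    simp only [dotProduct]
    rw [← Finset.sum_mul, hF.sum_finalMeasure hP, one_mul]
  -- The defect in the spectral equation is nonnegative on `F` and has zero `q`-average; since `q >
  -- 0` on `F`, it vanishes there.
  have h1 : q ⬝ᵥ (((fun _ => lam) + u) - (τ.meanRewardReal + τ.transMatrix *ᵥ u)) = 0 := by
    rw [dotProduct_sub, dotProduct_add, dotProduct_add, Matrix.dotProduct_mulVec, hst.2, h, h2]
    ring
  intro i hi
  have h3 := (Finset.sum_eq_zero_iff_of_nonneg fun j _ => ?_).1 h1 i (Finset.mem_univ i)
  · have h4 := (mul_eq_zero.1 h3).resolve_left (hF.finalMeasure_pos hP i hi).ne'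
    simp only [Pi.sub_apply, Pi.add_apply] at h4
    linarith
  · by_cases hj : j ∈ F
    · exact mul_nonneg (hst.1 j) (sub_nonneg.2 (hle j hj))
    · simp only [q, finalMeasure_eq_zero _ j hj, zero_mul, le_refl]

theorem reward_add_mulVec_eq_integral (τ : M.StationaryRule) (x : Fin n → ℝ) {i : Fin n}
    (hint : Integrable (M.rewardExt i) (τ.law i)) :
    τ.meanRewardReal i + (τ.transMatrix *ᵥ x) i =
      ∫ a, (M.rewardExt i a + ∑ j, M.transExt i a j * x j) ∂τ.law i := by
  rw [τ.transMatrix_mulVec, meanRewardReal, integral_add hint]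
  exact integrable_finsetSum _ fun j _ => (τ.integrable_transExt i j).mul_const _

theorem reward_add_mulVec_le (τ : M.StationaryRule) (x : Fin n → ℝ) {i : Fin n}
    (hint : Integrable (M.rewardExt i) (τ.law i)) :
    τ.meanRewardReal i + (τ.transMatrix *ᵥ x) i ≤ M.dpOperator x i := by
  rw [τ.reward_add_mulVec_eq_integral x hint]
  have h := integral_mono_ae (μ := τ.law i)
    (hint.add (integrable_finsetSum _ fun j _ => (τ.integrable_transExt i j).mul_const (x j)))
    (integrable_const (M.dpOperator x i))
    ((τ.ae_mem_act i).mono fun a ha => M.reward_add_le_dpOperator x i ha)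
  simpa using h

/-- The stationary rule that plays a finitely supported random action in each state. -/
noncomputable def ofFinite {ι : Fin n → Type*} [∀ i, Fintype (ι i)] (w : ∀ i, ι i → ℝ)
    (hw : ∀ i l, 0 ≤ w i l) (hw1 : ∀ i, ∑ l, w i l = 1) (a : ∀ i, ι i → A)
    (ha : ∀ i l, a i l ∈ M.act i) : M.StationaryRule where
  law i := ∑ l, ENNReal.ofReal (w i l) • Measure.dirac (a i l)
  isProb i := ⟨by
    simp only [Measure.coe_finsetSum, Finset.sum_apply, Measure.smul_apply, smul_eq_mul,
      measure_univ, mul_one]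
    rw [← ENNReal.ofReal_sum_of_nonneg fun l _ => hw i l, hw1, ENNReal.ofReal_one]⟩
  law_act i := by
    simp only [Measure.coe_finsetSum, Finset.sum_apply, Measure.smul_apply, smul_eq_mul,
      Measure.dirac_apply' _ (M.measurableSet_act i), Set.indicator_of_mem (ha i _),
      Pi.one_apply, mul_one]
    rw [← ENNReal.ofReal_sum_of_nonneg fun l _ => hw i l, hw1, ENNReal.ofReal_one]

section OfFinite

variable {ι : Fin n → Type*} [∀ i, Fintype (ι i)] {w : ∀ i, ι i → ℝ} (hw : ∀ i l, 0 ≤ w i l)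
  (hw1 : ∀ i, ∑ l, w i l = 1) {a : ∀ i, ι i → A} (ha : ∀ i l, a i l ∈ M.act i)

theorem integrable_ofFinite (i : Fin n) {g : A → ℝ} (hg : Measurable g) :
    Integrable g ((ofFinite w hw hw1 a ha).law i) := by
  refine integrable_finsetSum_measure.2 fun l _ => Integrable.smul_measure ?_ ENNReal.ofReal_ne_top
  exact integrable_dirac' hg.stronglyMeasurable (by simp)

theorem integral_ofFinite (i : Fin n) {g : A → ℝ} (hg : Measurable g) :
    ∫ x, g x ∂(ofFinite w hw hw1 a ha).law i = ∑ l, w i l * g (a i l) := by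
  have h : ∀ l ∈ Finset.univ, Integrable g (ENNReal.ofReal (w i l) • Measure.dirac (a i l)) :=
    fun l hl => integrable_finsetSum_measure.1 (integrable_ofFinite hw hw1 ha i hg) l hl
  simp only [ofFinite]
  rw [integral_finsetSum_measure h]
  refine Finset.sum_congr rfl fun l _ => ?_
  rw [integral_smul_measure, integral_dirac' _ _ hg.stronglyMeasurable,
    ENNReal.toReal_ofReal (hw i l), smul_eq_mul]

theorem ofFinite_eigen {u : Fin n → ℝ} {lam : ℝ} {i : Fin n}
    (h : ∀ l, M.rewardExt i (a i l) + ∑ j, M.transExt i (a i l) j * u j = lam + u i) :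
    (ofFinite w hw hw1 a ha).meanRewardReal i + ((ofFinite w hw hw1 a ha).transMatrix *ᵥ u) i =
      lam + u i := by
  have hm : Measurable fun b => M.rewardExt i b + ∑ j, M.transExt i b j * u j :=
    (M.measurable_rewardExt i).add ((M.measurable_trans_dot u).comp measurable_prodMk_left)
  rw [reward_add_mulVec_eq_integral _ _
    (integrable_ofFinite hw hw1 ha i (M.measurable_rewardExt i)), integral_ofFinite hw hw1 ha i hm]
  simp_rw [h]
  rw [← Finset.sum_mul, hw1, one_mul]

end OfFinite

end StationaryRule

end MarkovControlModel

/-! ### Subdifferentials of dynamic programming operators with compact action sets -/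

/-- Serves to pad a convex combination with zero weights up to a fixed number of terms. -/
theorem Function.Embedding.sum_eq_sum {ι κ G : Type*} [Fintype ι] [Fintype κ] [AddCommMonoid G]
    (e : ι ↪ κ) {g : ι → G} {g' : κ → G} (h1 : ∀ i, g' (e i) = g i)
    (h2 : ∀ l ∉ Set.range e, g' l = 0) : ∑ l, g' l = ∑ i, g i :=
  (Finset.sum_of_injOn e e.injective.injOn (fun _ _ => by simp)
    (fun l _ hl => h2 l (by simpa using hl)) fun i _ => (h1 i).symm).symm

/-- In finite dimension, the convex hull of a compact set is compact. -/
theorem IsCompact.convexHull_of_finiteDimensional {E : Type*} [NormedAddCommGroup E]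
    [NormedSpace ℝ E] [FiniteDimensional ℝ E] {s : Set E} (hs : IsCompact s) :
    IsCompact (convexHull ℝ s) := by
  -- Carathéodory's bound: `d` points always suffice, so the hull is a continuous image of a compact
  -- set of weights and points.
  let d := Module.finrank ℝ E + 1
  let f : (Fin d → ℝ) × (Fin d → E) → E := fun p => ∑ l, p.1 l • p.2 l
  have hf : Continuous f := by fun_prop
  have heq : convexHull ℝ s =
      f '' (stdSimplex ℝ (Fin d) ×ˢ (Set.univ.pi fun _ : Fin d => s)) := by
    apply Set.Subset.antisymm
    · intro x hx
      obtain ⟨ι, _, z, w, hz, hind, hw, hw1, hx⟩ := eq_pos_convex_span_of_mem_convexHull hx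
      obtain ⟨e⟩ : Nonempty (ι ↪ Fin d) :=
        Function.Embedding.nonempty_of_card_le (by
          rw [Fintype.card_fin]
          exact hind.card_le_finrank_succ.trans
            (Nat.add_le_add_right (Submodule.finrank_le _) 1))
      have hne : Nonempty ι := by
        by_contra h
        rw [not_nonempty_iff] at h
        simp at hw1
      obtain ⟨i₀⟩ := hne
      -- The added terms have weight `0`, but their points must still lie in `s`, whence the
      -- repeated `z i₀`.
      refine ⟨(Function.extend e w 0, Function.extend e z fun _ => z i₀), ⟨⟨fun l => ?_, ?_⟩,
        fun l _ => ?_⟩, ?_⟩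
      · by_cases hl : l ∈ Set.range e
        · obtain ⟨i, rfl⟩ := hl
          simpa [e.injective.extend_apply] using (hw i).le
        · simp [Function.extend_apply' _ _ _ hl]
      · rw [← hw1]
        exact e.sum_eq_sum (fun i => e.injective.extend_apply _ _ _)
          fun l hl => Function.extend_apply' _ _ _ hl
      · by_cases hl : l ∈ Set.range e
        · obtain ⟨i, rfl⟩ := hl
          simpa [e.injective.extend_apply] using hz ⟨i, rfl⟩
        · simpa [Function.extend_apply' _ _ _ hl] using hz ⟨i₀, rfl⟩
      · rw [← hx]
        refine e.sum_eq_sum (fun i => ?_) fun l hl => ?_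
        · simp [e.injective.extend_apply]
        · simp [Function.extend_apply' _ _ _ hl]
    · rintro _ ⟨⟨w, z⟩, ⟨hw, hz⟩, rfl⟩
      exact mem_convexHull_iff_exists_fintype.2
        ⟨Fin d, inferInstance, w, z, hw.1, hw.2, fun l => hz l (Set.mem_univ l), rfl⟩
  rw [heq]
  exact ((isCompact_stdSimplex ℝ (Fin d)).prod (isCompact_univ_pi fun _ => hs)).image hf

namespace MarkovControlModel

variable {n : ℕ} {A : Type*} [TopologicalSpace A] [MeasurableSpace A] [BorelSpace A]
  {M : MarkovControlModel n A}

/-- The transition probabilities of the actions that attain the maximum in `f_i(u)`. -/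
def optimalRows (M : MarkovControlModel n A) (u : Fin n → ℝ) (i : Fin n) : Set (Fin n → ℝ) :=
  {p | ∃ a ∈ M.act i, M.rewardExt i a + ∑ j, M.transExt i a j * u j = M.dpOperator u i ∧
    M.transExt i a = p}

theorem isCompact_optimalRows (M : MarkovControlModel n A) (u : Fin n → ℝ) (i : Fin n)
    (hc : IsCompact (M.act i)) (hr : Continuous (M.reward i)) (ht : Continuous (M.trans i)) :
    IsCompact (M.optimalRows u i) := by
  have : CompactSpace (M.act i) := isCompact_iff_compactSpace.1 hc
  have ht' : Continuous fun a : M.act i => (M.trans i a : Fin n → ℝ) :=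
    continuous_subtype_val.comp ht
  have hh : Continuous fun a : M.act i => M.reward i a + ∑ j, M.trans i a j * u j :=
    hr.add (continuous_finsetSum _ fun j _ => ((continuous_apply j).comp ht').mul_const _)
  have heq : M.optimalRows u i = (fun a : M.act i => (M.trans i a : Fin n → ℝ)) ''
      {a | M.reward i a + ∑ j, M.trans i a j * u j = M.dpOperator u i} := by
    ext p
    constructor
    · rintro ⟨a, ha, h1, h2⟩
      simp only [rewardExt, transExt, dif_pos ha] at h1 h2
      exact ⟨⟨a, ha⟩, h1, h2⟩
    · rintro ⟨⟨a, ha⟩, h1, h2⟩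
      refine ⟨a, ha, ?_⟩
      simp only [rewardExt, transExt, dif_pos ha]
      exact ⟨h1, h2⟩
  rw [heq]
  exact (isClosed_eq hh continuous_const).isCompact.image ht'

/-- Otherwise a direction `x` strictly separates `p` from the rows of optimal actions. Moving `u` a
little along `x`, the subgradient inequality forces the maximizing actions to satisfy `P x ≥ s`,
whereas by compactness such actions are worse at `u` by a fixed gap, which a small step cannot make
up. -/
theorem mem_convexHull_optimalRows (M : MarkovControlModel n A) (u : Fin n → ℝ) (i : Fin n)
    (hc : IsCompact (M.act i)) (hr : Continuous (M.reward i)) (ht : Continuous (M.trans i))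
    {p : Fin n → ℝ} (hp : ∀ x, p ⬝ᵥ (x - u) ≤ M.dpOperator x i - M.dpOperator u i) :
    p ∈ convexHull ℝ (M.optimalRows u i) := by
  by_contra hnot
  obtain ⟨g, s, hgs, hsp⟩ := geometric_hahn_banach_closed_point (convex_convexHull ℝ _)
    (M.isCompact_optimalRows u i hc hr ht).convexHull_of_finiteDimensional.isClosed hnot
  let x : Fin n → ℝ := fun j => g (Pi.single j 1)
  have hg : ∀ q : Fin n → ℝ, g q = q ⬝ᵥ x := fun q =>
    (g : (Fin n → ℝ) →ₗ[ℝ] ℝ).pi_apply_eq_sum_univ q |>.trans (by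
      simp only [dotProduct, smul_eq_mul, x]
      refine Finset.sum_congr rfl fun j _ => ?_
      refine congrArg (fun y => q j * g y) (funext fun l => ?_)
      simp [Pi.single_apply, eq_comm])
  have : CompactSpace (M.act i) := isCompact_iff_compactSpace.1 hc
  have ht' : Continuous fun a : M.act i => (M.trans i a : Fin n → ℝ) :=
    continuous_subtype_val.comp ht
  have hdot : ∀ y : Fin n → ℝ, Continuous fun a : M.act i => ∑ j, M.trans i a j * y j := fun y =>
    continuous_finsetSum _ fun j _ => ((continuous_apply j).comp ht').mul_const _
  -- The action is a maximizer at `u + t • x`. Since its value at `u` is at most `dpOperator u i`,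
  -- the subgradient inequality yields `p ⬝ᵥ x ≤ P x`, hence `s ≤ P x`.
  have hopt : ∀ t : ℝ, 0 < t → ∃ a : M.act i, s ≤ ∑ j, M.trans i a j * x j ∧
      M.dpOperator u i + t * (p ⬝ᵥ x) ≤
        M.reward i a + ∑ j, M.trans i a j * u j + t * ∑ j, M.trans i a j * x j := by
    intro t htpos
    obtain ⟨a, ha, hopt⟩ := M.exists_eq_dpOperator (u + t • x) i
    have h1 := hp (u + t • x)
    have h2 := M.reward_add_le_dpOperator u i ha
    rw [add_sub_cancel_left, dotProduct_smul, smul_eq_mul, ← hopt] at h1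
    simp only [rewardExt, transExt, dif_pos ha, Pi.add_apply, Pi.smul_apply, smul_eq_mul, mul_add,
      Finset.sum_add_distrib] at h1 h2
    have h3 : ∑ j, M.trans i ⟨a, ha⟩ j * (t * x j) = t * ∑ j, M.trans i ⟨a, ha⟩ j * x j := by
      rw [Finset.mul_sum]
      exact Finset.sum_congr rfl fun j _ => by ring
    rw [h3] at h1
    refine ⟨⟨a, ha⟩, ?_, by linarith⟩
    have h4 : p ⬝ᵥ x ≤ ∑ j, M.trans i ⟨a, ha⟩ j * x j := by
      refine le_of_mul_le_mul_left ?_ htpos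
      linarith
    rw [hg] at hsp
    exact hsp.le.trans h4
  obtain ⟨a₁, ha₁, -⟩ := hopt 1 one_pos
  -- The best value at `u` among actions with `P x ≥ s`. Optimal actions satisfy `P x < s`, so this
  -- value falls short by the positive gap `δ` below.
  obtain ⟨a₀, ha₀, hmax⟩ := (isClosed_le continuous_const (hdot x)).isCompact.exists_isMaxOn
    (s := {a : M.act i | s ≤ ∑ j, M.trans i a j * x j}) ⟨a₁, ha₁⟩
    (hr.add (hdot u)).continuousOn
  have hlt : M.reward i a₀ + ∑ j, M.trans i a₀ j * u j < M.dpOperator u i := by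
    have hle := M.reward_add_le_dpOperator u i a₀.2
    simp only [rewardExt, transExt, dif_pos a₀.2] at hle
    refine lt_of_le_of_ne hle fun heq => ?_
    have := hgs (M.trans i a₀) (subset_convexHull ℝ _ ⟨a₀, a₀.2, by
      simpa only [rewardExt, transExt, dif_pos a₀.2, and_true] using heq⟩)
    rw [hg] at this
    exact absurd ha₀ (not_le.2 this)
  set δ := M.dpOperator u i - (M.reward i a₀ + ∑ j, M.trans i a₀ j * u j) with hδ
  have hδpos : 0 < δ := sub_pos.2 hlt
  set D := ∑ j, |x j| - p ⬝ᵥ x with hD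
  -- A step `t` gains at most `t * D` relative to `p`, and this choice makes `t * D < δ`, so the gap
  -- cannot be recovered.
  obtain ⟨a, ha, hineq⟩ := hopt (δ / (|D| + 1)) (by positivity)
  have h1 : M.reward i a + ∑ j, M.trans i a j * u j ≤
      M.reward i a₀ + ∑ j, M.trans i a₀ j * u j := hmax ha
  have h2 : ∑ j, M.trans i a j * x j ≤ ∑ j, |x j| := by
    have := (le_abs_self _).trans (M.abs_sum_transExt_mul_le x i a)
    simpa only [transExt, dif_pos a.2] using this
  have h3 := mul_le_mul_of_nonneg_left h2 (by positivity : 0 ≤ δ / (|D| + 1))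
  have h4 : δ ≤ δ / (|D| + 1) * D := by
    rw [hD, mul_sub]
    linarith
  have h5 : δ / (|D| + 1) * D < δ := by
    rw [div_mul_eq_mul_div, div_lt_iff₀ (by positivity)]
    nlinarith [le_abs_self D]
  linarith

/-- With compact action sets and continuous data, each matrix in the subdifferential at an
eigenvector is the transition matrix of a stationary rule that attains the maximum in the spectral
equation. -/
theorem exists_rule_of_mem_subdifferential (M : MarkovControlModel n A) {u : Fin n → ℝ} {lam : ℝ}
    (hu : IsAddEigenvector M.dpOperator lam u) (hc : ∀ i, IsCompact (M.act i))
    (hr : ∀ i, Continuous (M.reward i)) (ht : ∀ i, Continuous (M.trans i))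
    {P : Matrix (Fin n) (Fin n) ℝ} (hP : P ∈ subdifferential M.dpOperator u) :
    ∃ τ : M.StationaryRule, τ.transMatrix = P ∧
      (∀ i, Integrable (M.rewardExt i) (τ.law i)) ∧
      ∀ i, τ.meanRewardReal i + (τ.transMatrix *ᵥ u) i = lam + u i := by
  have hmem : ∀ i, P i ∈ convexHull ℝ (M.optimalRows u i) := fun i =>
    M.mem_convexHull_optimalRows u i (hc i) (hr i) (ht i) fun x => hP x i
  simp_rw [mem_convexHull_iff_exists_fintype] at hmem
  choose ι hι w z hw hw1 hz hsum using hmem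
  choose a ha hopt hrow using hz
  refine ⟨StationaryRule.ofFinite w hw hw1 a ha, ?_,
    fun i => StationaryRule.integrable_ofFinite hw hw1 ha i (M.measurable_rewardExt i),
    fun i => StationaryRule.ofFinite_eigen hw hw1 ha fun l => (hopt i l).trans (hu i)⟩
  funext i j
  rw [StationaryRule.transMatrix, StationaryRule.integral_ofFinite hw hw1 ha i
    (M.measurable_transExt i j), ← hsum i]
  simp [hrow]

/-- A row of transition probabilities that attains the maximum is a subgradient. -/
theorem exists_mem_subdifferential_of_rule (M : MarkovControlModel n A) (τ : M.StationaryRule)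
    {F : Finset (Fin n)} {u : Fin n → ℝ}
    (hint : ∀ i ∈ F, Integrable (M.rewardExt i) (τ.law i))
    (h : ∀ i ∈ F, τ.meanRewardReal i + (τ.transMatrix *ᵥ u) i = M.dpOperator u i) :
    ∃ Q ∈ subdifferential M.dpOperator u, ∀ i ∈ F, Q i = τ.transMatrix i := by
  classical
  choose a ha hopt using fun i => M.exists_eq_dpOperator u i
  -- Membership in the subdifferential is checked row by row, so the rows outside `F`, where `τ`
  -- need not be optimal, are replaced by those of optimal actions.
  refine ⟨fun i => if i ∈ F then τ.transMatrix i else M.transExt i (a i), fun x i => ?_,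
    fun i hi => if_pos hi⟩
  by_cases hi : i ∈ F
  · have h1 := τ.reward_add_mulVec_le x (hint i hi)
    rw [Pi.sub_apply, ← h i hi]
    simp only [Matrix.mulVec, if_pos hi, dotProduct_sub] at h1 ⊢
    linarith
  · have h1 := M.reward_add_le_dpOperator x i (ha i)
    rw [Pi.sub_apply, ← hopt i]
    simp only [Matrix.mulVec, if_neg hi, dotProduct_sub]
    simp only [dotProduct]
    linarith

theorem criticalFinalClasses_dpOperator (M : MarkovControlModel n A) {u : Fin n → ℝ} {lam : ℝ}
    (hu : IsAddEigenvector M.dpOperator lam u) (hc : ∀ i, IsCompact (M.act i))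
    (hr : ∀ i, Continuous (M.reward i)) (ht : ∀ i, Continuous (M.trans i)) :
    criticalFinalClasses M.dpOperator u =
      {F | ∃ τ : M.StationaryRule, IsFinalClass τ.transMatrix F ∧
        τ.classReward F = (lam : EReal)} := by
  ext F
  constructor
  · rintro ⟨P, hP, hF⟩
    obtain ⟨τ, rfl, hint, heig⟩ := M.exists_rule_of_mem_subdifferential hu hc hr ht hP
    exact ⟨τ, hF, τ.classReward_eq_of_eigen hF (fun i _ => hint i) fun i _ => heig i⟩
  · rintro ⟨τ, hF, hlam⟩
    -- A finite class reward rules out non-integrable rewards on `F`.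
    have hint := τ.integrable_of_classReward_ne_bot hF (by rw [hlam]; exact EReal.coe_ne_bot _)
    have heig := τ.eigen_of_classReward_eq hF (u := u) hint
      (fun i hi => (τ.reward_add_mulVec_le u (hint i hi)).trans_eq (hu i)) hlam
    obtain ⟨Q, hQ, hrows⟩ := M.exists_mem_subdifferential_of_rule τ hint
      fun i hi => (heig i hi).trans (hu i).symm
    exact ⟨Q, hQ, hF.congr hrows⟩

/-- Some stationary rule attains the eigenvalue. -/
theorem exists_rule_meanReward_eq (M : MarkovControlModel n A) (hn : 0 < n) {u : Fin n → ℝ}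
    {lam : ℝ} (hu : IsAddEigenvector M.dpOperator lam u) :
    ∃ (τ : M.StationaryRule) (i : Fin n), τ.toStrategy.meanReward i = lam := by
  choose a ha hopt using fun i => M.exists_eq_dpOperator u i
  -- With a one-point index set, the rule plays the optimal action `a i` with probability one.
  have hw : ∀ (i : Fin n) (l : Unit), (0 : ℝ) ≤ (fun _ _ => 1) i l := fun _ _ => zero_le_one
  have hw1 : ∀ i : Fin n, ∑ l : Unit, (fun _ _ => (1 : ℝ)) i l = 1 := fun _ => by simp
  have ha' : ∀ (i : Fin n) (l : Unit), (fun i _ => a i) i l ∈ M.act i := fun i _ => ha i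
  let τ := StationaryRule.ofFinite _ hw hw1 _ ha'
  obtain ⟨F, hF, -⟩ := exists_isFinalClass_hasAccess τ.transMatrix ⟨0, hn⟩
  obtain ⟨i, hi⟩ := hF.nonempty
  refine ⟨τ, i, ?_⟩
  rw [τ.meanReward_eq_classReward hF hi]
  exact τ.classReward_eq_of_eigen hF
    (fun i _ => StationaryRule.integrable_ofFinite hw hw1 ha' i (M.measurable_rewardExt i))
    fun i _ => StationaryRule.ofFinite_eigen hw hw1 ha' fun _ => (hopt i).trans (hu i)

theorem isGreatest_meanReward_strategy (M : MarkovControlModel n A) (hn : 0 < n) {u : Fin n → ℝ}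
    {lam : ℝ} (hu : IsAddEigenvector M.dpOperator lam u) :
    IsGreatest (Set.range fun p : M.Strategy × Fin n => p.1.meanReward p.2) (lam : EReal) := by
  refine ⟨?_, ?_⟩
  · obtain ⟨τ, i, h⟩ := M.exists_rule_meanReward_eq hn hu
    exact ⟨(τ.toStrategy, i), h⟩
  · rintro _ ⟨⟨γ, i⟩, rfl⟩
    exact γ.meanReward_le i fun j a ha => (M.reward_add_le_dpOperator u j ha).trans_eq (hu j)

end MarkovControlModel

theorem proposition7p2 {n : ℕ} (hn : 0 < n) {A : Type*} [TopologicalSpace A] [MeasurableSpace A]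
    [BorelSpace A] (M : MarkovControlModel n A) (u : Fin n → ℝ) (lam : ℝ)
    (hu : IsAddEigenvector M.dpOperator lam u) :
    IsGreatest (Set.range fun p : M.Strategy × Fin n => p.1.meanReward p.2) (lam : EReal) ∧
    IsGreatest (Set.range fun p : M.StationaryRule × Fin n => p.1.toStrategy.meanReward p.2)
      (lam : EReal) ∧
    (∀ (τ : M.StationaryRule) (F : Finset (Fin n)), IsFinalClass τ.transMatrix F →
      ∃! m, IsInvariantMeasureOn τ.transMatrix F m) ∧
    (∀ τ : M.StationaryRule, ∃ v : EReal,
      IsGreatest (Set.range fun i : Fin n => τ.toStrategy.meanReward i) v ∧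
      IsGreatest (τ.classReward '' {F | IsFinalClass τ.transMatrix F}) v) ∧
    ((∀ i, IsCompact (M.act i)) → (∀ i, Continuous (M.reward i)) →
      (∀ i, Continuous (M.trans i)) →
      criticalFinalClasses M.dpOperator u =
        {F | ∃ τ : M.StationaryRule, IsFinalClass τ.transMatrix F ∧
          τ.classReward F = (lam : EReal)}) := by
  have hmax := M.isGreatest_meanReward_strategy hn hu
  refine ⟨hmax, ⟨?_, ?_⟩,
    fun τ F hF => hF.existsUnique_isInvariantMeasureOn τ.transMatrix_mem_rowStochastic,
    fun τ => ?_, M.criticalFinalClasses_dpOperator hu⟩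
  · obtain ⟨τ, i, h⟩ := M.exists_rule_meanReward_eq hn hu
    exact ⟨(τ, i), h⟩
  · rintro _ ⟨⟨τ, i⟩, rfl⟩
    exact hmax.2 ⟨(τ.toStrategy, i), rfl⟩
  · obtain ⟨F, -, h⟩ := τ.exists_isGreatest hn
    exact ⟨_, h⟩
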